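/- **Setting.** Let $\mathcal X,\mathcal Y$ be Polish spaces with their Borel $\sigma$-algebras, $\mathscr P(\cdot)$ the set of Borel probability measures with the narrow topology (duality with bounded continuous functions), and $\mu\in\mathscr P(\mathcal X)$ without atoms. Let $c:\mathcal X\times\mathcal Y\to[0,+\infty]$, $L:\mathcal Y\to[0,+\infty]$, $H:\mathcal Y\times\mathcal Y\to[0,+\infty]$ be lower semicontinuous, $H$ symmetric, and $\{L\le\kappa\}$ compact for every $\kappa>0$. Write $\mathcal L(\nu)=\int L\,d\nu$, $\mathcal H(\nu,\nu')=\int H\,d(\nu\otimes\nu')$, and $\mathscr P_\mu=\{\gamma\in\mathscr P(\mathcal X\times\mathcal Y):(\pi_{\mathcal X})_\sharp\gamma=\mu\}$. For $\gamma\in\mathscr P_\mu$ with second marginal $\nu$ let $$\mathcal J(\gamma)=\int c\,d\gamma+\mathcal L(\nu)+\mathcal H(\nu,\nu),$$ and $\mathcal J=+\infty$ outside $\mathscr P_\mu$. Let $$\Phi(x,y,\nu)=c(x,y)+L(y)+2\int_{\mathcal Y}H(y,y')\,d\nu(y').$$ A *Cournot–Nash equilibrium* is a $\gamma\in\mathscr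 P_\mu$ such that, for $\gamma$-a.e. $(x,y)$, $y$ minimizes $\Phi(x,\cdot,\nu)$ over $\mathcal Y$, where $\nu=(\pi_{\mathcal Y})_\sharp\gamma$. Let $X_1,X_2,\dots$ be i.i.d. $\mathcal X$-valued random variables with law $\mu$ on a probability space $(\Omega,\mathcal F,\mathbb P)$. For $\omega\in\Omega$ put $x_i=X_i(\omega)$. In the *closed-loop game* with $N\ge1$ players, player $i$ chooses $\nu_i\in\mathscr P(\mathcal Y)$ and pays $$\int c(x_i,y)\,d\nu_i(y)+\mathcal L(\nu_i)+\frac2N\sum_{j\ne i}\mathcal H(\nu_i,\nu_j).$$ A profile $(\nu_i)_{i=1}^N$ is identified with the plan $\gamma_N=\frac1N\sum_{i=1}^N\delta_{x_i}\otimes\nu_i$ (almost surely the $x_i$ are pairwise distinct, and the profile is then determined by the plan); the plan is called a *closed-loop Nash equilibrium* if no player can lower their cost by a unilateral deviation. The potential $\mathcal J_{\omega,N}:\mathscr P(\mathcal X\times\mathcal Y)\to[0,+\infty]$ is $$\mathcal J_{\omega,N}(\gamma_N)=\int c\,d\gamma_N+\frac1N\sum_{i=1}^N\mathcal L(\nu_i)+\frac1{N^2}\sum_{i\ne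 j}\mathcal H(\nu_i,\nu_j)$$ if $\gamma_N=\frac1N\sum_i\delta_{x_i}\otimes\nu_i$ for some profile, and $+\infty$ otherwise. *Condition (R)*: for every $n\in\mathbb N$ there are $0<C_n<\infty$ and a measurable family $(\nu_n^y)_{y\in\mathcal Y}\subset\mathscr P(\mathcal Y)$ such that $\mathcal H(\nu_n^y,\nu_n^{y'})\le C_n(1+L(y)+L(y'))$ for all $y,y'\in\mathcal Y$, and $\int\Phi(x,z,\nu)\,d\nu_n^y(z)\to\Phi(x,y,\nu)$ as $n\to\infty$ whenever $\Phi(x,y,\nu)<\infty$. **Theorem.** Assume $\inf_{\mathscr P_\mu}\mathcal J<\infty$. 1. Almost surely, $\mathcal J_{\omega,N}$ has a minimizer for every $N\ge1$, and for every sequence $(\gamma_N)_{N\ge1}$ of minimizers of $\mathcal J_{\omega,N}$: each $\gamma_N$ is a closed-loop Nash equilibrium, and a subsequence of $(\gamma_N)$ converges narrowly to some $\gamma\in\mathscr P_\mu$ which, if condition (R) holds, is a Cournot–Nash equilibrium. 2. If moreover $H$ is (finite,) continuous and bounded, then almost surely the following holds: whenever $(\gamma_N)_{N\ge1}$ is a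 sequence of closed-loop Nash equilibria ($\gamma_N$ for the game with $N$ players) that converges narrowly to some $\gamma\in\mathscr P(\mathcal X\times\mathcal Y)$, then $\gamma\in\mathscr P_\mu$ and $\gamma$ is a Cournot–Nash equilibrium. -/

import Mathlib

open MeasureTheory ProbabilityTheory Filter Topology
open scoped ENNReal NNReal

namespace CournotNash

/-- Nash equilibrium of the `N`-player game in which player `i` chooses an element of `S` and pays
`g i s` under the profile `s`: no player can lower their cost by a unilateral deviation. -/
def IsNashEquilibrium {S : Type*} {N : ℕ} (g : Fin N → (Fin N → S) → ℝ≥0∞) (s : Fin N → S) :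
    Prop :=
  ∀ (i : Fin N) (s' : S), g i s ≤ g i (Function.update s i s')

section

variable {X Y : Type*} [MeasurableSpace X] [MeasurableSpace Y]

/-- The second marginal of a plan. -/
noncomputable def sndMarginal (γ : ProbabilityMeasure (X × Y)) : ProbabilityMeasure Y :=
  γ.map measurable_snd.aemeasurable

/-- The set of plans on `X × Y` whose first marginal is `μ`. -/
def plansOver (Y : Type*) [MeasurableSpace Y] (μ : ProbabilityMeasure X) :
    Set (ProbabilityMeasure (X × Y)) :=
  {γ | (γ : Measure (X × Y)).map Prod.fst = (μ : Measure X)}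

/-- Cournot--Nash equilibrium for the cost `Φ x y ν` and the distribution of types `μ`: a plan
with first marginal `μ` such that, for almost every `(x, y)`, the strategy `y` minimizes
`Φ x · ν`, where `ν` is the second marginal of the plan. -/
def IsCournotNash (Φ : X → Y → ProbabilityMeasure Y → ℝ≥0∞) (μ : ProbabilityMeasure X)
    (γ : ProbabilityMeasure (X × Y)) : Prop :=
  γ ∈ plansOver Y μ ∧
    ∀ᵐ z ∂(γ : Measure (X × Y)), ∀ y' : Y, Φ z.1 z.2 (sndMarginal γ) ≤ Φ z.1 y' (sndMarginal γ)

/-- The mean individual cost `∫ L dν`. -/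
noncomputable def meanCost (L : Y → ℝ≥0∞) (ν : ProbabilityMeasure Y) : ℝ≥0∞ :=
  ∫⁻ y, L y ∂(ν : Measure Y)

/-- The pairwise interaction energy `∫ H d(ν ⊗ ν')`. -/
noncomputable def interaction (H : Y × Y → ℝ≥0∞) (ν ν' : ProbabilityMeasure Y) : ℝ≥0∞ :=
  ∫⁻ z, H z ∂((ν : Measure Y).prod (ν' : Measure Y))

/-- The cost of the game with a continuum of players,
`Φ(x, y, ν) = c(x, y) + L(y) + 2 ∫ H(y, y') dν(y')`. -/
noncomputable def meanFieldCost (c : X × Y → ℝ≥0∞) (L : Y → ℝ≥0∞) (H : Y × Y → ℝ≥0∞)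
    (x : X) (y : Y) (ν : ProbabilityMeasure Y) : ℝ≥0∞ :=
  c (x, y) + L y + 2 * ∫⁻ y', H (y, y') ∂(ν : Measure Y)

open Classical in
/-- The potential of the game with a continuum of players: `∫ c dγ + ∫ L dν + ∫ H d(ν ⊗ ν)` with
`ν` the second marginal of `γ`, if the first marginal of `γ` is `μ`, and `+∞` otherwise. -/
noncomputable def limitPotential (c : X × Y → ℝ≥0∞) (L : Y → ℝ≥0∞) (H : Y × Y → ℝ≥0∞)
    (μ : ProbabilityMeasure X) (γ : ProbabilityMeasure (X × Y)) : ℝ≥0∞ :=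
  if γ ∈ plansOver Y μ then
    ∫⁻ z, c z ∂(γ : Measure (X × Y)) + meanCost L (sndMarginal γ)
      + interaction H (sndMarginal γ) (sndMarginal γ)
  else ⊤

/-- The plan `(1/N) ∑ i, δ_{x i} ⊗ ν i` that lifts a profile `ν` of mixed strategies of `N`
players of types `x`. -/
noncomputable def profilePlan {N : ℕ} (x : Fin N → X) (ν : Fin N → ProbabilityMeasure Y) :
    Measure (X × Y) :=
  (N : ℝ≥0∞)⁻¹ • ∑ i, (Measure.dirac (x i)).prod (ν i : Measure Y)

/-- The cost of player `i` in the closed-loop game of `N` players of types `x`, in mixed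
strategies. -/
noncomputable def closedLoopCost (c : X × Y → ℝ≥0∞) (L : Y → ℝ≥0∞) (H : Y × Y → ℝ≥0∞)
    {N : ℕ} (x : Fin N → X) (i : Fin N) (ν : Fin N → ProbabilityMeasure Y) : ℝ≥0∞ :=
  ∫⁻ y, c (x i, y) ∂(ν i : Measure Y) + meanCost L (ν i)
    + 2 / (N : ℝ≥0∞) * ∑ j with j ≠ i, interaction H (ν i) (ν j)

/-- The plan `γ` describes a Nash equilibrium of the closed-loop game of `N` players of types
`x`. -/
def IsClosedLoopNash (c : X × Y → ℝ≥0∞) (L : Y → ℝ≥0∞) (H : Y × Y → ℝ≥0∞)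
    {N : ℕ} (x : Fin N → X) (γ : ProbabilityMeasure (X × Y)) : Prop :=
  ∃ ν : Fin N → ProbabilityMeasure Y,
    (γ : Measure (X × Y)) = profilePlan x ν ∧ IsNashEquilibrium (closedLoopCost c L H x) ν

/-- The potential of the closed-loop game at the plan `γ`:
`∫ c dγ + (1/N) ∑ i, ∫ L dν i + (1/N²) ∑_{i ≠ j} ∫ H d(ν i ⊗ ν j)` if `γ` is the plan of a
profile `ν`, and `+∞` otherwise. For pairwise distinct types the profile is determined by `γ`, so
that the infimum is over at most one profile; the infimum over no profile is `+∞`. -/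
noncomputable def closedLoopPotential (c : X × Y → ℝ≥0∞) (L : Y → ℝ≥0∞) (H : Y × Y → ℝ≥0∞)
    {N : ℕ} (x : Fin N → X) (γ : ProbabilityMeasure (X × Y)) : ℝ≥0∞ :=
  ⨅ (ν : Fin N → ProbabilityMeasure Y) (_ : (γ : Measure (X × Y)) = profilePlan x ν),
    (∫⁻ z, c z ∂(γ : Measure (X × Y)) + (N : ℝ≥0∞)⁻¹ * ∑ i, meanCost L (ν i)
      + ((N : ℝ≥0∞) ^ 2)⁻¹ * ∑ i, ∑ j with j ≠ i, interaction H (ν i) (ν j))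

/-- `γ` minimizes the potential of the closed-loop game over all plans. -/
def IsClosedLoopMinimizer (c : X × Y → ℝ≥0∞) (L : Y → ℝ≥0∞) (H : Y × Y → ℝ≥0∞)
    {N : ℕ} (x : Fin N → X) (γ : ProbabilityMeasure (X × Y)) : Prop :=
  ∀ γ' : ProbabilityMeasure (X × Y),
    closedLoopPotential c L H x γ ≤ closedLoopPotential c L H x γ'

/-- The regularization condition: there are constants `0 < C n < ∞` and measurable families of
probability measures `y ↦ κ n y` on `Y` such that the interaction energy of `κ n y` and `κ n y'`
is at most `C n * (1 + L y + L y')`, and `∫ Φ(x, z, ν) d(κ n y)(z) → Φ(x, y, ν)` as `n → ∞`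
whenever `Φ(x, y, ν)` is finite. -/
def RegularizationCondition (c : X × Y → ℝ≥0∞) (L : Y → ℝ≥0∞) (H : Y × Y → ℝ≥0∞) : Prop :=
  ∃ (C : ℕ → ℝ≥0) (κ : ℕ → Kernel Y Y),
    (∀ n, 0 < C n) ∧ (∀ n, IsMarkovKernel (κ n)) ∧
    (∀ n y y', ∫⁻ z, H z ∂((κ n y).prod (κ n y')) ≤ (C n : ℝ≥0∞) * (1 + L y + L y')) ∧
    (∀ (x : X) (y : Y) (ν : ProbabilityMeasure Y), meanFieldCost c L H x y ν < ⊤ →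
      Tendsto (fun n => ∫⁻ z, meanFieldCost c L H x z ν ∂(κ n y)) atTop
        (𝓝 (meanFieldCost c L H x y ν)))

end

end CournotNash

/-! Minimizers. The `N`-player game is a potential game: by the symmetry of `H`, the energy of a
profile depends on `ν i` only through `1/N` times the cost of player `i` (`profileEnergy_eq`). A
profile of finite minimal energy is therefore a Nash equilibrium, and minimizers exist by the direct
method.

To pass to the limit, let `m` be the infimum of the limit potential. The lower bound
(`exists_subseq_tendsto_of_profileEnergy_le`) is compactness and lower semicontinuity. The
self-interactions `i = j`, absent from the discrete potential, are restored by truncating `H` at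
height `k`, which costs `k/N`. The upper bound is obtained in expectation: disintegrate a nearly
optimal plan as `μ ⊗ κ` and let a player of type `x` play `κ x`. Distinct players have independent
types, so the expected energy is at most the limit potential of the plan. Fatou bounds the mean of
the liminf of these energies by nearly `m`, while the lower bound makes every such liminf at least
`m`; hence the infimum of the liminfs over a sequence of nearly optimal plans is almost surely `m`
(`ae_frequently_exists_profileEnergy_lt`). Along a random subsequence of `N` the minimal energies
thus do not exceed `m` in the limit, and a further subsequence of the minimizers converges to a
minimizer of the limit potential.

A minimizer of the limit potential satisfies a first-order condition, `∫ Φ dγ ≤ ∫ Φ dγ'`, against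
competitors of finite self-interaction (`lintegral_meanFieldCost_le`). A measurable near best
response `T` may have infinite self-interaction, so condition (R) replaces `T x` by `κ n (T x)`,
only where this lowers the cost, and then `n → ∞`.

Bounded continuous `H`. An arbitrary equilibrium need not minimize the potential. Instead, the
equilibrium inequalities for the deviations `x i ↦ T (x i)` are averaged over the players and passed
to the limit by the law of large numbers. The null set depends on `T`, but the limiting bound is
continuous in the second marginal, which ranges over a second countable space, so countably many `T`
suffice (`exists_countable_subfamily`). Near best responses then give the pointwise condition. -/

namespace CournotNash

/-! ### Lower semicontinuity and coercivity of integral functionals -/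

section Semicontinuity

variable {E : Type*} [TopologicalSpace E] [MeasurableSpace E]

theorem iSup_min_natCast (a : ℝ≥0∞) : ⨆ k : ℕ, min a (k : ℝ≥0∞) = a := by
  have h : ⨆ k : ℕ, a ⊓ (k : ℝ≥0∞) = a ⊓ ⨆ k : ℕ, (k : ℝ≥0∞) := (inf_iSup_eq a _).symm
  rw [ENNReal.iSup_natCast, inf_top_eq] at h
  exact h

/-- Layer cake and Fatou: superlevel sets of `f` are open. Truncation at `k` makes `f` finite, as
the real-valued layer-cake formula requires; monotone convergence removes it. -/
theorem lintegral_le_liminf_of_lowerSemicontinuous [OpensMeasurableSpace E]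
    {μ : Measure E} {μs : ℕ → Measure E} {f : E → ℝ≥0∞} (hf : LowerSemicontinuous f)
    (h_opens : ∀ G, IsOpen G → μ G ≤ atTop.liminf (fun i ↦ μs i G)) :
    ∫⁻ x, f x ∂μ ≤ atTop.liminf (fun i ↦ ∫⁻ x, f x ∂(μs i)) := by
  have hmeas : ∀ k : ℕ, Measurable fun x => min (f x) (k : ℝ≥0∞) :=
    fun k => hf.measurable.min measurable_const
  have key : ∀ k : ℕ, ∫⁻ x, min (f x) k ∂μ ≤ atTop.liminf (fun i ↦ ∫⁻ x, f x ∂(μs i)) := by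
    intro k
    have hne : ∀ x, min (f x) (k : ℝ≥0∞) ≠ ⊤ :=
      fun x => ne_top_of_le_ne_top (ENNReal.natCast_ne_top k) (min_le_right _ _)
    have e : ∀ ν : Measure E, ∫⁻ x, min (f x) k ∂ν
        = ∫⁻ t in Set.Ioi (0 : ℝ), ν {a | t < (min (f a) (k : ℝ≥0∞)).toReal} := by
      intro ν
      rw [← lintegral_eq_lintegral_meas_lt ν (Eventually.of_forall fun _ => ENNReal.toReal_nonneg)
        (hmeas k).ennreal_toReal.aemeasurable]
      exact lintegral_congr fun x => (ENNReal.ofReal_toReal (hne x)).symm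
    calc ∫⁻ x, min (f x) k ∂μ
        ≤ ∫⁻ t in Set.Ioi (0 : ℝ),
            atTop.liminf fun i => μs i {a | t < (min (f a) (k : ℝ≥0∞)).toReal} := by
          rw [e]
          refine setLIntegral_mono' measurableSet_Ioi fun t ht => h_opens _ ?_
          have : {a | t < (min (f a) (k : ℝ≥0∞)).toReal}
              = (fun a => min (f a) (k : ℝ≥0∞)) ⁻¹' Set.Ioi (ENNReal.ofReal t) := by
            ext a
            exact (ENNReal.ofReal_lt_iff_lt_toReal (le_of_lt ht) (hne a)).symm
          rw [this]
          exact (hf.inf lowerSemicontinuous_const).isOpen_preimage _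
      _ ≤ atTop.liminf fun i => ∫⁻ x, min (f x) k ∂(μs i) := by
          simp_rw [e]
          exact lintegral_liminf_le fun n => Antitone.measurable fun s t hst =>
            measure_mono fun ω hω => lt_of_le_of_lt hst hω
      _ ≤ _ := liminf_le_liminf (Eventually.of_forall fun i =>
          lintegral_mono fun x => min_le_left _ _)
  calc ∫⁻ x, f x ∂μ = ∫⁻ x, ⨆ k : ℕ, min (f x) (k : ℝ≥0∞) ∂μ := by simp_rw [iSup_min_natCast]
    _ = ⨆ k : ℕ, ∫⁻ x, min (f x) (k : ℝ≥0∞) ∂μ :=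
        lintegral_iSup hmeas fun i j hij x => min_le_min le_rfl (by exact_mod_cast hij)
    _ ≤ _ := iSup_le key

variable [PolishSpace E] [BorelSpace E]

theorem lowerSemicontinuous_lintegral {f : E → ℝ≥0∞} (hf : LowerSemicontinuous f) :
    LowerSemicontinuous fun ν : ProbabilityMeasure E => ∫⁻ x, f x ∂(ν : Measure E) := by
  rw [lowerSemicontinuous_iff_isClosed_preimage]
  intro r
  refine IsSeqClosed.isClosed fun ν ν₀ hν hlim => ?_
  refine (lintegral_le_liminf_of_lowerSemicontinuous hf fun G hG =>
    ProbabilityMeasure.le_liminf_measure_open_of_tendsto hlim hG).trans ?_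
  refine liminf_le_of_frequently_le' (Frequently.of_forall fun n => hν n)

/-- Markov's inequality gives tightness, and Prokhorov's theorem compactness. -/
theorem isCompact_setOf_lintegral_le {f : E → ℝ≥0∞} (hf : LowerSemicontinuous f)
    (hcomp : ∀ r : ℝ≥0, 0 < r → IsCompact {y : E | f y ≤ r}) (r : ℝ≥0) :
    IsCompact {ν : ProbabilityMeasure E | ∫⁻ x, f x ∂(ν : Measure E) ≤ r} := by
  have hclosed : IsClosed {ν : ProbabilityMeasure E | ∫⁻ x, f x ∂(ν : Measure E) ≤ r} :=
    (lowerSemicontinuous_lintegral hf).isClosed_preimage _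
  rw [← hclosed.closure_eq]
  refine isCompact_closure_of_isTightMeasureSet ?_
  rw [isTightMeasureSet_iff_exists_isCompact_measure_compl_le]
  intro ε hε
  rcases eq_or_ne ε ⊤ with rfl | hε'
  · exact ⟨∅, isCompact_empty, fun _ _ => le_top⟩
  lift ε to ℝ≥0 using hε'
  have hε0 : 0 < ε := by exact_mod_cast hε
  -- The level is `(r + 1) / ε` rather than `r / ε` because compactness is only assumed at positive
  -- levels and `r` may vanish.
  refine ⟨_, hcomp ((r + 1) / ε) (by positivity), ?_⟩
  rintro _ ⟨ν, hν, rfl⟩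
  have h1 := mul_meas_ge_le_lintegral (μ := (ν : Measure E)) hf.measurable
    (((r + 1) / ε : ℝ≥0) : ℝ≥0∞)
  have h2 : (((r + 1) / ε : ℝ≥0) : ℝ≥0∞) * (ν : Measure E) {y | f y ≤ ((r + 1) / ε : ℝ≥0)}ᶜ
      ≤ r := by
    refine le_trans ?_ (h1.trans hν)
    gcongr
    intro y hy
    exact le_of_lt (lt_of_not_ge (show ¬ f y ≤ _ from hy))
  have h3 : ((ν : Measure E) {y | f y ≤ ((r + 1) / ε : ℝ≥0)}ᶜ) ≠ ⊤ := measure_ne_top _ _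
  generalize (ν : Measure E) {y | f y ≤ ((r + 1) / ε : ℝ≥0)}ᶜ = a at h2 h3
  lift a to ℝ≥0 using h3
  norm_cast at h2 ⊢
  have h4 : (r + 1) * a ≤ r * ε := by
    rw [div_mul_eq_mul_div, div_le_iff₀ hε0] at h2
    exact h2
  by_contra hlt
  push Not at hlt
  have : r * ε < (r + 1) * a := by
    calc r * ε ≤ (r + 1) * ε := by gcongr; simp
      _ < (r + 1) * a := by gcongr
  exact absurd h4 (not_le.2 this)

end Semicontinuity

/-! ### Countably many test functions determine the narrow topology -/

section Countable

variable (E : Type*) [TopologicalSpace E] [MeasurableSpace E] [PolishSpace E] [BorelSpace E]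

/-- By the portmanteau theorem it suffices to bound the mass of open sets from below. Finite unions
`U T` of basic open sets exhaust any open set from inside, and the continuous functions
approximating the closed complement of `U T` from above control its mass. -/
theorem exists_countable_isInducing_lintegral :
    ∃ (ι : Type) (_ : Countable ι) (f : ι → BoundedContinuousFunction E ℝ≥0),
      IsInducing fun (ν : ProbabilityMeasure E) (i : ι) => ∫⁻ x, f i x ∂(ν : Measure E) := by
  let B := TopologicalSpace.countableBasis E
  have hB : Countable B := TopologicalSpace.countable_countableBasis E
  obtain ⟨e, he⟩ := exists_injective_nat B
  have hopen : ∀ T : Finset ℕ, IsOpen (⋃ b : B, ⋃ (_ : e b ∈ T), (b : Set E)) := fun T =>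
    isOpen_iUnion fun b => isOpen_iUnion fun _ => TopologicalSpace.isOpen_of_mem_countableBasis b.2
  let U : Finset ℕ → Set E := fun T => ⋃ b : B, ⋃ (_ : e b ∈ T), (b : Set E)
  have hcl : ∀ T, IsClosed (U T)ᶜ := fun T => (hopen T).isClosed_compl
  refine ⟨Finset ℕ × ℕ, inferInstance, fun i => (hcl i.1).apprSeq i.2, ?_⟩
  rw [isInducing_iff_nhds]
  intro ν
  refine le_antisymm ?_ ?_
  · rw [← map_le_iff_le_comap]
    exact (continuous_pi fun i =>
      ProbabilityMeasure.continuous_lintegral_boundedContinuousFunction _).tendsto ν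
  · set l := comap (fun (ν : ProbabilityMeasure E) (i : Finset ℕ × ℕ) =>
      ∫⁻ x, ((hcl i.1).apprSeq i.2 x : ℝ≥0∞) ∂(ν : Measure E))
      (𝓝 fun i => ∫⁻ x, ((hcl i.1).apprSeq i.2 x : ℝ≥0∞) ∂(ν : Measure E)) with hl
    have hlim : ∀ i : Finset ℕ × ℕ, Tendsto (fun ν : ProbabilityMeasure E =>
        ∫⁻ x, ((hcl i.1).apprSeq i.2 x : ℝ≥0∞) ∂(ν : Measure E)) l
        (𝓝 (∫⁻ x, ((hcl i.1).apprSeq i.2 x : ℝ≥0∞) ∂(ν : Measure E))) := by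
      have h : Tendsto (fun (ν : ProbabilityMeasure E) (i : Finset ℕ × ℕ) =>
        ∫⁻ x, ((hcl i.1).apprSeq i.2 x : ℝ≥0∞) ∂(ν : Measure E)) l
        (𝓝 fun i => ∫⁻ x, ((hcl i.1).apprSeq i.2 x : ℝ≥0∞) ∂(ν : Measure E)) := tendsto_comap
      exact tendsto_pi_nhds.1 h
    change Tendsto id l (𝓝 ν)
    refine tendsto_of_forall_isOpen_le_liminf' fun G hG => ?_
    refine le_of_forall_lt_imp_le_of_dense fun r hr => ?_
    obtain ⟨T, hTG, hT⟩ : ∃ T : Finset ℕ, U T ⊆ G ∧ r < (ν : Measure E) (U T) := by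
      let V : Finset ℕ → Set E := fun T => ⋃ b : B, ⋃ (_ : e b ∈ T ∧ (b : Set E) ⊆ G), (b : Set E)
      have hV : G = ⋃ T, V T := by
        ext x
        simp only [V, Set.mem_iUnion, exists_prop]
        constructor
        · intro hx
          obtain ⟨b, hb, hxb, hbG⟩ :=
            (TopologicalSpace.isBasis_countableBasis E).exists_subset_of_mem_open hx hG
          exact ⟨{e ⟨b, hb⟩}, ⟨b, hb⟩, ⟨by simp, hbG⟩, hxb⟩
        · rintro ⟨T, b, ⟨-, hb⟩, hx⟩
          exact hb hx
      have hmono : Monotone V := fun S T hST =>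
        Set.iUnion_mono fun b => Set.iUnion_mono' fun h => ⟨⟨hST h.1, h.2⟩, subset_rfl⟩
      rw [hV, hmono.directed_le.measure_iUnion, lt_iSup_iff] at hr
      obtain ⟨T, hT⟩ := hr
      classical
      refine ⟨T.filter fun n => ∃ b : B, e b = n ∧ (b : Set E) ⊆ G, ?_, hT.trans_le ?_⟩
      · intro x hx
        simp only [U, Set.mem_iUnion, Finset.mem_filter, exists_prop] at hx
        obtain ⟨b, ⟨-, b', hb', hsub⟩, hx⟩ := hx
        rw [← he hb'] at hx
        exact hsub hx
      · refine measure_mono fun x hx => ?_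
        simp only [V, U, Set.mem_iUnion, Finset.mem_filter, exists_prop] at hx ⊢
        obtain ⟨b, ⟨h1, h2⟩, hx⟩ := hx
        exact ⟨b, ⟨h1, b, rfl, h2⟩, hx⟩
    have hmeasU : MeasurableSet (U T) := (hopen T).measurableSet
    have hc : r + (ν : Measure E) (U T)ᶜ < 1 := by
      rw [← prob_add_prob_compl (μ := (ν : Measure E)) hmeasU]
      exact ENNReal.add_lt_add_right (measure_ne_top _ _) hT
    obtain ⟨m, hm⟩ := ((HasOuterApproxClosed.tendsto_lintegral_apprSeq (hcl T)
      (ν : Measure E)).const_add r |>.eventually_lt_const hc).exists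
    suffices hev : ∀ᶠ ν' : ProbabilityMeasure E in l, r ≤ (ν' : Measure E) G from
      le_liminf_of_le (by isBoundedDefault) hev
    filter_upwards [((hlim (T, m)).const_add r).eventually_lt_const hm] with ν' hν'
    rw [← prob_add_prob_compl (μ := (ν' : Measure E)) hmeasU] at hν'
    have h1 := HasOuterApproxClosed.measure_le_lintegral (hcl T) (ν' : Measure E) m
    have h2 : r + (ν' : Measure E) (U T)ᶜ < (ν' : Measure E) (U T) + (ν' : Measure E) (U T)ᶜ :=
      (add_le_add le_rfl h1).trans_lt hν'
    exact (lt_of_add_lt_add_right h2).le.trans (measure_mono hTG)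

instance : SecondCountableTopology (ProbabilityMeasure E) := by
  obtain ⟨ι, _, f, hf⟩ := exists_countable_isInducing_lintegral E
  exact hf.secondCountableTopology

end Countable

/-! ### Law of large numbers for empirical measures -/

section Empirical

variable {X Ω : Type*} [MeasurableSpace X] [MeasurableSpace Ω]

/-- The empirical measure of the first `n + 1` terms of the sequence `x`. -/
noncomputable def empirical (x : ℕ → X) (n : ℕ) : ProbabilityMeasure X :=
  ⟨((n + 1 : ℕ) : ℝ≥0∞)⁻¹ • ∑ i ∈ Finset.range (n + 1), Measure.dirac (x i), ⟨by
    simp only [Measure.smul_apply, Measure.finsetSum_apply, measure_univ, Finset.sum_const,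
      Finset.card_range, nsmul_eq_mul, mul_one, smul_eq_mul]
    exact ENNReal.inv_mul_cancel (by simp) (ENNReal.natCast_ne_top _)⟩⟩

theorem lintegral_empirical (x : ℕ → X) (n : ℕ) {f : X → ℝ≥0∞} (hf : Measurable f) :
    ∫⁻ z, f z ∂(empirical x n : Measure X)
      = ((n + 1 : ℕ) : ℝ≥0∞)⁻¹ * ∑ i ∈ Finset.range (n + 1), f (x i) := by
  change ∫⁻ z, f z ∂(((n + 1 : ℕ) : ℝ≥0∞)⁻¹ • ∑ i ∈ Finset.range (n + 1), Measure.dirac (x i)) = _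
  rw [lintegral_smul_measure, lintegral_finsetSum_measure, smul_eq_mul]
  congr 1
  exact Finset.sum_congr rfl fun i _ => lintegral_dirac' _ hf

variable {P : Measure Ω} {μ : Measure X} {ξ : ℕ → Ω → X}

theorem ae_tendsto_lintegral_empirical (hξ_meas : ∀ i, Measurable (ξ i)) (hξ_indep : iIndepFun ξ P)
    (hξ_law : ∀ i, P.map (ξ i) = μ) {g : X → ℝ≥0∞} (hg : Measurable g)
    (hfin : ∫⁻ x, g x ∂μ ≠ ⊤) :
    ∀ᵐ ω ∂P, Tendsto (fun n => ∫⁻ x, g x ∂(empirical (fun i => ξ i ω) n : Measure X)) atTop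
      (𝓝 (∫⁻ x, g x ∂μ)) := by
  have hlint : ∀ i, ∫⁻ ω, g (ξ i ω) ∂P = ∫⁻ x, g x ∂μ := fun i => by
    rw [← hξ_law i, lintegral_map hg (hξ_meas i)]
  have hgr : Measurable fun x => (g x).toReal := hg.ennreal_toReal
  have hint : Integrable (fun ω => (g (ξ 0 ω)).toReal) P :=
    integrable_toReal_of_lintegral_ne_top (hg.comp (hξ_meas 0)).aemeasurable
      (by simpa only [Function.comp_def, hlint] using hfin)
  have hlaw := strong_law_ae_real (fun i ω => (g (ξ i ω)).toReal) hint
    (fun i j hij => (hξ_indep.indepFun hij).comp hgr hgr)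
    (fun i => IdentDistrib.comp (u := fun x => (g x).toReal)
      ⟨(hξ_meas i).aemeasurable, (hξ_meas 0).aemeasurable, by rw [hξ_law, hξ_law]⟩ hgr)
  have htop : ∀ᵐ ω ∂P, ∀ i, g (ξ i ω) < ⊤ := ae_all_iff.2 fun i =>
    ae_lt_top (hg.comp (hξ_meas i)) (by simpa only [Function.comp_def, hlint] using hfin)
  have hmean : ∫ ω, (g (ξ 0 ω)).toReal ∂P = (∫⁻ x, g x ∂μ).toReal := by
    rw [integral_toReal (f := fun ω => g (ξ 0 ω)) (hg.comp (hξ_meas 0)).aemeasurable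
      (htop.mono fun ω h => h 0), hlint]
  filter_upwards [hlaw, htop] with ω h1 h2
  rw [hmean] at h1
  have h3 := ENNReal.tendsto_ofReal (h1.comp (tendsto_add_atTop_nat 1))
  rw [ENNReal.ofReal_toReal hfin] at h3
  refine h3.congr fun n => ?_
  rw [lintegral_empirical _ _ hg]
  simp only [Function.comp_apply]
  rw [ENNReal.ofReal_div_of_pos (by positivity), ENNReal.ofReal_natCast,
    ENNReal.ofReal_sum_of_nonneg fun i _ => ENNReal.toReal_nonneg, ENNReal.div_eq_inv_mul]
  congr 1
  exact Finset.sum_congr rfl fun i _ => ENNReal.ofReal_toReal (h2 i).ne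

/-- Varadarajan's theorem: the strong law is applied to countably many test functions, so that the
exceptional sets add up to a null set. -/
theorem ae_tendsto_empirical [TopologicalSpace X] [PolishSpace X] [BorelSpace X]
    {μ : ProbabilityMeasure X} (hξ_meas : ∀ i, Measurable (ξ i)) (hξ_indep : iIndepFun ξ P)
    (hξ_law : ∀ i, P.map (ξ i) = (μ : Measure X)) :
    ∀ᵐ ω ∂P, Tendsto (empirical fun i => ξ i ω) atTop (𝓝 μ) := by
  obtain ⟨ι, _, f, hf⟩ := exists_countable_isInducing_lintegral X
  have h : ∀ᵐ ω ∂P, ∀ k, Tendsto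
      (fun n => ∫⁻ x, f k x ∂(empirical (fun i => ξ i ω) n : Measure X)) atTop
      (𝓝 (∫⁻ x, f k x ∂(μ : Measure X))) := ae_all_iff.2 fun k =>
    ae_tendsto_lintegral_empirical hξ_meas hξ_indep hξ_law
      (f k).continuous.measurable.coe_nnreal_ennreal
      ((f k).lintegral_lt_top_of_nnreal _).ne
  filter_upwards [h] with ω hω
  rw [hf.tendsto_nhds_iff, tendsto_pi_nhds]
  exact hω

end Empirical

/-! ### Measurable selection of near-minimizers -/

section Selection

variable {X Y : Type*} [TopologicalSpace X] [TopologicalSpace Y] {Φ : X × Y → ℝ≥0∞}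

theorem isClosed_setOf_exists_le {S : Type*} [TopologicalSpace S] [CompactSpace S]
    {q : S → Y} (hq : Continuous q) (hΦ : LowerSemicontinuous Φ) (r : ℝ≥0∞) {F : Set S}
    (hF : IsClosed F) : IsClosed {x | ∃ s ∈ F, Φ (x, q s) ≤ r} := by
  have h : IsClosed {z : X × S | z.2 ∈ F ∧ Φ (z.1, q z.2) ≤ r} :=
    (hF.preimage continuous_snd).inter
      ((hΦ.isClosed_preimage r).preimage (continuous_fst.prodMk (hq.comp continuous_snd)))
  have h2 := isClosedMap_fst_of_compactSpace _ h
  convert h2 using 1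
  ext x
  simp

variable [MeasurableSpace X] [BorelSpace X] [PolishSpace Y] [MeasurableSpace Y] [BorelSpace Y]

/-- The compact set `K` is a continuous image of the Cantor set, and `T x` is the image of the least
parameter at which `Φ (x, ·) ≤ r`. Projections along a compact factor are closed, which makes this
least parameter measurable in `x`. -/
theorem exists_measurable_le [Nonempty Y] (hΦ : LowerSemicontinuous Φ) {r : ℝ≥0∞} {K : Set Y}
    (hK : IsCompact K) (hΦK : ∀ x y, Φ (x, y) ≤ r → y ∈ K) :
    MeasurableSet {x | ∃ y, Φ (x, y) ≤ r} ∧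
      ∃ T : X → Y, Measurable T ∧ ∀ x, (∃ y, Φ (x, y) ≤ r) → Φ (x, T x) ≤ r := by
  rcases K.eq_empty_or_nonempty with rfl | hne
  · have h : ∀ x, ¬ ∃ y, Φ (x, y) ≤ r := fun x ⟨y, hy⟩ => hΦK x y hy
    simp only [h]
    exact ⟨by simp, fun _ => Classical.arbitrary Y, measurable_const, by simp⟩
  let : MetricSpace K := TopologicalSpace.metrizableSpaceMetric K
  have : Nonempty K := hne.to_subtype
  have : CompactSpace K := isCompact_iff_compactSpace.1 hK
  obtain ⟨q, hq, hq_surj⟩ := exists_nat_bool_continuous_surjective_of_compact K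
  let p : cantorSet → Y := fun s => q (cantorSetHomeomorphNatToBool s)
  have hp : Continuous p :=
    continuous_subtype_val.comp (hq.comp cantorSetHomeomorphNatToBool.continuous)
  have hp_surj : ∀ y ∈ K, ∃ s, p s = y := by
    intro y hy
    obtain ⟨b, hb⟩ := hq_surj ⟨y, hy⟩
    exact ⟨cantorSetHomeomorphNatToBool.symm b, by simp [p, hb]⟩
  have : CompactSpace cantorSet := cantorSetHomeomorphNatToBool.symm.compactSpace
  have hcantor : IsCompact cantorSet := isCompact_iff_compactSpace.2 inferInstance
  have hexists : ∀ x, (∃ y, Φ (x, y) ≤ r) ↔ ∃ s ∈ (Set.univ : Set cantorSet), Φ (x, p s) ≤ r := by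
    intro x
    constructor
    · rintro ⟨y, hy⟩
      obtain ⟨s, rfl⟩ := hp_surj y (hΦK x y hy)
      exact ⟨s, trivial, hy⟩
    · rintro ⟨s, -, hs⟩
      exact ⟨_, hs⟩
  have hB : MeasurableSet {x | ∃ y, Φ (x, y) ≤ r} := by
    simp only [hexists]
    exact (isClosed_setOf_exists_le hp hΦ r isClosed_univ).measurableSet
  let S : X → Set ℝ := fun x => (↑) '' {s : cantorSet | Φ (x, p s) ≤ r}
  have hS_compact : ∀ x, IsCompact (S x) := fun x =>
    ((hΦ.isClosed_preimage r).preimage (continuous_const.prodMk hp)).isCompact.image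
      continuous_subtype_val
  have hS_mem : ∀ x, (∃ y, Φ (x, y) ≤ r) → sInf (S x) ∈ S x := fun x hx => by
    obtain ⟨s, -, hs⟩ := (hexists x).1 hx
    exact (hS_compact x).sInf_mem ⟨s, s, hs, rfl⟩
  have hmeas : Measurable fun x => sInf (S x) := by
    refine measurable_of_Iic fun a => ?_
    -- The second set accounts for the convention `sInf ∅ = 0` at points without admissible
    -- parameter.
    have : (fun x => sInf (S x)) ⁻¹' Set.Iic a
        = {x | ∃ s ∈ {s : cantorSet | (s : ℝ) ≤ a}, Φ (x, p s) ≤ r} ∪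
          ({x | ∃ y, Φ (x, y) ≤ r}ᶜ ∩ {_x | (0 : ℝ) ≤ a}) := by
      ext x
      by_cases hx : ∃ y, Φ (x, y) ≤ r
      · simp only [Set.mem_preimage, Set.mem_Iic, Set.mem_union, Set.mem_inter_iff,
          Set.mem_compl_iff, Set.mem_ofPred_eq, hx, not_true_eq_false, false_and, or_false]
        constructor
        · intro h
          obtain ⟨s, hs, hs'⟩ := hS_mem x hx
          exact ⟨s, hs'.trans_le h, hs⟩
        · rintro ⟨s, hs, hs'⟩
          exact (csInf_le (hS_compact x).bddBelow ⟨s, hs', rfl⟩).trans hs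
      · have h0 : S x = ∅ := by
          refine Set.eq_empty_of_forall_notMem ?_
          rintro _ ⟨s, hs, rfl⟩
          exact hx ⟨_, hs⟩
        have h1 : ¬ ∃ s ∈ {s : cantorSet | (s : ℝ) ≤ a}, Φ (x, p s) ≤ r :=
          fun ⟨s, _, hs⟩ => hx ⟨_, hs⟩
        simp only [Set.mem_preimage, Set.mem_Iic, Set.mem_union, Set.mem_inter_iff,
          Set.mem_compl_iff, Set.mem_ofPred_eq, hx, h0, Real.sInf_empty]
        simp only [Set.mem_ofPred_eq] at h1
        simp [h1]
    rw [this]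
    refine (isClosed_setOf_exists_le hp hΦ r ?_).measurableSet.union
      (hB.compl.inter (MeasurableSet.const _))
    exact isClosed_le continuous_subtype_val continuous_const
  have hemb : MeasurableEmbedding ((↑) : cantorSet → ℝ) :=
    MeasurableEmbedding.subtype_coe hcantor.measurableSet
  refine ⟨hB, fun x => Function.extend ((↑) : cantorSet → ℝ) p
    (fun _ => Classical.arbitrary Y) (sInf (S x)),
    (hemb.measurable_extend hp.measurable measurable_const).comp hmeas, fun x hx => ?_⟩
  obtain ⟨s, hs, hs'⟩ := hS_mem x hx
  simp only [← hs', Subtype.val_injective.extend_apply]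
  exact hs

/-- The levels `k * ε` form a grid: selecting at the first level that `Φ (x, ·)` reaches loses at
most `ε`. -/
theorem exists_measurable_near_minimizer [Nonempty Y] (hΦ : LowerSemicontinuous Φ)
    (hΦ_compact : ∀ r : ℝ≥0, ∃ K : Set Y, IsCompact K ∧ ∀ x y, Φ (x, y) ≤ r → y ∈ K)
    {ε : ℝ≥0} (hε : 0 < ε) :
    ∃ T : X → Y, Measurable T ∧ ∀ x, (⨅ y, Φ (x, y)) < ⊤ → Φ (x, T x) ≤ (⨅ y, Φ (x, y)) + ε := by
  classical
  have h : ∀ k : ℕ, MeasurableSet {x | ∃ y, Φ (x, y) ≤ ((k * ε : ℝ≥0) : ℝ≥0∞)} ∧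
      ∃ T : X → Y, Measurable T ∧ ∀ x, (∃ y, Φ (x, y) ≤ ((k * ε : ℝ≥0) : ℝ≥0∞)) →
        Φ (x, T x) ≤ ((k * ε : ℝ≥0) : ℝ≥0∞) := by
    intro k
    obtain ⟨K, hK, hK'⟩ := hΦ_compact (k * ε)
    exact exists_measurable_le hΦ hK hK'
  choose hB T hT_meas hT using h
  let B : ℕ → Set X := fun k => {x | ∃ y, Φ (x, y) ≤ ((k * ε : ℝ≥0) : ℝ≥0∞)}
  -- Points reaching no level, where the infimum is infinite, are assigned to index `0` so that the
  -- search always terminates.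
  let p : ℕ → X → Prop := fun k x => x ∈ B k ∨ x ∈ (⋃ k, B k)ᶜ
  have hp : ∀ x, ∃ k, p k x := by
    intro x
    by_cases hx : x ∈ ⋃ k, B k
    · obtain ⟨k, hk⟩ := Set.mem_iUnion.1 hx
      exact ⟨k, Or.inl hk⟩
    · exact ⟨0, Or.inr hx⟩
  refine ⟨fun x => T (Nat.find (hp x)) x, Measurable.find (p := p) hT_meas
    (fun k => (hB k).union (MeasurableSet.iUnion hB).compl) hp, fun x hx => ?_⟩
  have hxB : x ∈ ⋃ k, B k := by
    obtain ⟨y, hy⟩ := iInf_lt_iff.1 hx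
    obtain ⟨k, hk⟩ := exists_nat_ge ((Φ (x, y)).toNNReal / ε)
    refine Set.mem_iUnion.2 ⟨k, y, ?_⟩
    rw [div_le_iff₀ hε] at hk
    rw [← ENNReal.coe_toNNReal hy.ne]
    exact_mod_cast hk
  have hfind : x ∈ B (Nat.find (hp x)) := (Nat.find_spec (hp x)).resolve_right fun h => h hxB
  refine (hT _ x hfind).trans ?_
  rcases Nat.eq_zero_or_pos (Nat.find (hp x)) with h0 | hpos
  · rw [h0]
    simp
  · obtain ⟨k, hk⟩ := Nat.exists_eq_succ_of_ne_zero hpos.ne'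
    have hnot : ¬ p k x := Nat.find_min (hp x) (by omega)
    have hle : ((k * ε : ℝ≥0) : ℝ≥0∞) ≤ ⨅ y, Φ (x, y) := le_iInf fun y => by
      by_contra hy
      exact hnot (Or.inl ⟨y, (not_le.1 hy).le⟩)
    rw [hk]
    calc (((k.succ : ℕ) * ε : ℝ≥0) : ℝ≥0∞) = ((k * ε : ℝ≥0) : ℝ≥0∞) + ε := by
          push_cast; ring
      _ ≤ _ := add_le_add hle le_rfl

end Selection

/-! ### Plans and energies of profiles -/

section Profile

variable {X Y : Type*} [MeasurableSpace X] [MeasurableSpace Y] {N : ℕ}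

/-- The energy of a profile `ν` of mixed strategies of `N` players of types `x`. -/
noncomputable def profileEnergy (c : X × Y → ℝ≥0∞) (L : Y → ℝ≥0∞) (H : Y × Y → ℝ≥0∞)
    (x : Fin N → X) (ν : Fin N → ProbabilityMeasure Y) : ℝ≥0∞ :=
  (N : ℝ≥0∞)⁻¹ * ∑ i, ∫⁻ y, c (x i, y) ∂(ν i : Measure Y) + (N : ℝ≥0∞)⁻¹ * ∑ i, meanCost L (ν i)
    + ((N : ℝ≥0∞) ^ 2)⁻¹ * ∑ i, ∑ j with j ≠ i, interaction H (ν i) (ν j)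

theorem lintegral_profilePlan (x : Fin N → X) (ν : Fin N → ProbabilityMeasure Y)
    {f : X × Y → ℝ≥0∞} (hf : Measurable f) :
    ∫⁻ z, f z ∂(profilePlan x ν) = (N : ℝ≥0∞)⁻¹ * ∑ i, ∫⁻ y, f (x i, y) ∂(ν i : Measure Y) := by
  rw [profilePlan, lintegral_smul_measure, lintegral_finsetSum_measure, smul_eq_mul]
  congr 1
  refine Finset.sum_congr rfl fun i _ => ?_
  rw [lintegral_prod _ hf.aemeasurable, lintegral_dirac' _ hf.lintegral_prod_right']

theorem lintegral_profilePlan_fst (x : Fin N → X) (ν : Fin N → ProbabilityMeasure Y)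
    {f : X → ℝ≥0∞} (hf : Measurable f) :
    ∫⁻ z, f z.1 ∂(profilePlan x ν) = (N : ℝ≥0∞)⁻¹ * ∑ i, f (x i) := by
  rw [lintegral_profilePlan x ν (f := fun z => f z.1) (by fun_prop)]
  simp

theorem lintegral_profilePlan_snd (x : Fin N → X) (ν : Fin N → ProbabilityMeasure Y)
    {f : Y → ℝ≥0∞} (hf : Measurable f) :
    ∫⁻ z, f z.2 ∂(profilePlan x ν) = (N : ℝ≥0∞)⁻¹ * ∑ i, ∫⁻ y, f y ∂(ν i : Measure Y) :=
  lintegral_profilePlan x ν (f := fun z => f z.2) (by fun_prop)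

theorem isProbabilityMeasure_profilePlan (hN : 1 ≤ N) (x : Fin N → X)
    (ν : Fin N → ProbabilityMeasure Y) : IsProbabilityMeasure (profilePlan x ν) := by
  constructor
  rw [← lintegral_one, lintegral_profilePlan x ν measurable_const]
  simp only [lintegral_const, measure_univ, mul_one, Finset.sum_const, Finset.card_univ,
    Fintype.card_fin, nsmul_eq_mul]
  exact ENNReal.inv_mul_cancel (by simp; omega) (ENNReal.natCast_ne_top _)

theorem map_fst_profilePlan (x : ℕ → X) (n : ℕ) (ν : Fin (n + 1) → ProbabilityMeasure Y) :
    (profilePlan (fun i : Fin (n + 1) => x i) ν).map Prod.fst = (empirical x n : Measure X) := by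
  ext s hs
  rw [← lintegral_indicator_one hs, ← lintegral_indicator_one hs,
    lintegral_map (measurable_one.indicator hs) measurable_fst,
    lintegral_profilePlan_fst _ _ (measurable_one.indicator hs),
    lintegral_empirical _ _ (measurable_one.indicator hs), Finset.sum_range]

theorem closedLoopPotential_eq {c : X × Y → ℝ≥0∞} (hc : Measurable c) (L : Y → ℝ≥0∞)
    (H : Y × Y → ℝ≥0∞) (x : Fin N → X) (γ : ProbabilityMeasure (X × Y)) :
    closedLoopPotential c L H x γ
      = ⨅ (ν : Fin N → ProbabilityMeasure Y) (_ : (γ : Measure (X × Y)) = profilePlan x ν),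
          profileEnergy c L H x ν := by
  unfold closedLoopPotential
  refine iInf_congr fun ν => iInf_congr fun h => ?_
  rw [h, lintegral_profilePlan x ν hc, profileEnergy]

theorem lintegral_sndMarginal (γ : ProbabilityMeasure (X × Y)) {f : Y → ℝ≥0∞}
    (hf : Measurable f) :
    ∫⁻ y, f y ∂(sndMarginal γ : Measure Y) = ∫⁻ z, f z.2 ∂(γ : Measure (X × Y)) :=
  lintegral_map hf measurable_snd

theorem interaction_eq_lintegral {H : Y × Y → ℝ≥0∞} (hH : Measurable H)
    (ν ν' : ProbabilityMeasure Y) :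
    interaction H ν ν' = ∫⁻ y, ∫⁻ y', H (y, y') ∂(ν' : Measure Y) ∂(ν : Measure Y) :=
  lintegral_prod _ hH.aemeasurable

theorem interaction_comm {H : Y × Y → ℝ≥0∞} (hH : Measurable H)
    (hH_symm : ∀ y y', H (y, y') = H (y', y)) (ν ν' : ProbabilityMeasure Y) :
    interaction H ν ν' = interaction H ν' ν := by
  rw [interaction, lintegral_prod_symm _ hH.aemeasurable, interaction_eq_lintegral hH]
  simp_rw [fun y y' => hH_symm y y']

theorem sum_eq_sum_ne_add (a : Fin N → ℝ≥0∞) (i : Fin N) :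
    ∑ j, a j = ∑ j with j ≠ i, a j + a i := by
  rw [← Finset.sum_filter_add_sum_filter_not Finset.univ (· ≠ i) a]
  simp [Finset.filter_eq']

theorem interaction_sndMarginal_right {H : Y × Y → ℝ≥0∞} (hH : Measurable H) {x : Fin N → X}
    {ν : Fin N → ProbabilityMeasure Y} {γ : ProbabilityMeasure (X × Y)}
    (hγ : (γ : Measure (X × Y)) = profilePlan x ν) (ν' : ProbabilityMeasure Y) :
    interaction H ν' (sndMarginal γ) = (N : ℝ≥0∞)⁻¹ * ∑ j, interaction H ν' (ν j) := by
  have h : ∀ y, ∫⁻ y', H (y, y') ∂(sndMarginal γ : Measure Y)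
      = (N : ℝ≥0∞)⁻¹ * ∑ j, ∫⁻ y', H (y, y') ∂(ν j : Measure Y) := fun y => by
    rw [lintegral_sndMarginal γ (f := fun y' => H (y, y')) (by fun_prop), hγ,
      lintegral_profilePlan x ν (f := fun z => H (y, z.2)) (by fun_prop)]
  simp_rw [interaction_eq_lintegral hH, h]
  have hm : ∀ j, Measurable fun y => ∫⁻ y', H (y, y') ∂(ν j : Measure Y) :=
    fun j => hH.lintegral_prod_right'
  rw [lintegral_const_mul _ (by fun_prop), lintegral_finsetSum _ fun j _ => hm j]

theorem interaction_sndMarginal {H : Y × Y → ℝ≥0∞} (hH : Measurable H) {x : Fin N → X}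
    {ν : Fin N → ProbabilityMeasure Y} {γ : ProbabilityMeasure (X × Y)}
    (hγ : (γ : Measure (X × Y)) = profilePlan x ν) :
    interaction H (sndMarginal γ) (sndMarginal γ)
      = ((N : ℝ≥0∞) ^ 2)⁻¹ * ∑ i, ∑ j, interaction H (ν i) (ν j) := by
  have hm : Measurable fun y => ∫⁻ y', H (y, y') ∂(sndMarginal γ : Measure Y) :=
    hH.lintegral_prod_right'
  rw [interaction_eq_lintegral hH, lintegral_sndMarginal γ hm, hγ,
    lintegral_profilePlan_snd x ν hm]
  simp_rw [← interaction_eq_lintegral hH, interaction_sndMarginal_right hH hγ, ← Finset.mul_sum]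
  rw [← mul_assoc, sq, ENNReal.mul_inv (Or.inr (ENNReal.natCast_ne_top _))
    (Or.inl (ENNReal.natCast_ne_top _))]

/-- The diagonal terms `i = j` are missing from the discrete potential. Below height `K` these `N`
terms, of weight `1/N²`, add at most `K/N`. -/
theorem interaction_sndMarginal_le {H : Y × Y → ℝ≥0∞} (hH : Measurable H) {x : Fin N → X}
    {ν : Fin N → ProbabilityMeasure Y} {γ : ProbabilityMeasure (X × Y)}
    (hγ : (γ : Measure (X × Y)) = profilePlan x ν) (K : ℝ≥0) :
    interaction (fun z => min (H z) K) (sndMarginal γ) (sndMarginal γ)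
      ≤ ((N : ℝ≥0∞) ^ 2)⁻¹ * ∑ i, ∑ j with j ≠ i, interaction H (ν i) (ν j)
        + (N : ℝ≥0∞)⁻¹ * K := by
  have hle : ∀ i, ∑ j, interaction (fun z => min (H z) K) (ν i) (ν j)
      ≤ ∑ j with j ≠ i, interaction H (ν i) (ν j) + K := by
    intro i
    rw [sum_eq_sum_ne_add _ i]
    refine add_le_add (Finset.sum_le_sum fun j _ => lintegral_mono fun z => min_le_left _ _) ?_
    exact (lintegral_mono fun z => min_le_right _ _).trans (by simp)
  rw [interaction_sndMarginal (hH.min measurable_const) hγ]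
  refine (mul_le_mul_right (Finset.sum_le_sum fun i _ => hle i) _).trans ?_
  rw [Finset.sum_add_distrib, mul_add]
  refine add_le_add le_rfl ?_
  simp only [Finset.sum_const, Finset.card_univ, Fintype.card_fin, nsmul_eq_mul]
  rw [← mul_assoc, sq, ENNReal.mul_inv (Or.inr (ENNReal.natCast_ne_top _))
    (Or.inl (ENNReal.natCast_ne_top _)), mul_assoc, mul_assoc]
  refine mul_le_mul_right ?_ _
  rw [← mul_assoc]
  exact (mul_le_mul_left (ENNReal.inv_mul_le_one _) _).trans (by simp)

theorem iSup_interaction_min {H : Y × Y → ℝ≥0∞} (hH : Measurable H) (ν ν' : ProbabilityMeasure Y) :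
    ⨆ k : ℕ, interaction (fun z => min (H z) ((k : ℝ≥0) : ℝ≥0∞)) ν ν' = interaction H ν ν' := by
  unfold interaction
  rw [← lintegral_iSup (fun k => hH.min measurable_const)
    fun i j hij z => min_le_min le_rfl (by simpa using hij)]
  exact lintegral_congr fun z => by simpa using iSup_min_natCast (H z)

theorem map_fst_eq_empirical {x : ℕ → X} {n : ℕ} {ν : Fin (n + 1) → ProbabilityMeasure Y}
    {γ : ProbabilityMeasure (X × Y)}
    (hγ : (γ : Measure (X × Y)) = profilePlan (fun i : Fin (n + 1) => x i) ν) :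
    γ.map measurable_fst.aemeasurable = empirical x n := by
  apply Subtype.ext
  change (γ : Measure (X × Y)).map Prod.fst = (empirical x n : Measure X)
  rw [hγ, map_fst_profilePlan]

theorem truncated_energy_le {c : X × Y → ℝ≥0∞} {L : Y → ℝ≥0∞} {H : Y × Y → ℝ≥0∞}
    (hc : Measurable c) (hL : Measurable L) (hH : Measurable H)
    {x : Fin N → X} {ν : Fin N → ProbabilityMeasure Y} {γ : ProbabilityMeasure (X × Y)}
    (hγ : (γ : Measure (X × Y)) = profilePlan x ν) (K : ℝ≥0) :
    ∫⁻ z, c z ∂(γ : Measure (X × Y)) + meanCost L (sndMarginal γ)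
      + interaction (fun z => min (H z) K) (sndMarginal γ) (sndMarginal γ)
      ≤ profileEnergy c L H x ν + (N : ℝ≥0∞)⁻¹ * K := by
  rw [profileEnergy, add_assoc _ _ (_ * (K : ℝ≥0∞)), meanCost, lintegral_sndMarginal γ hL, hγ,
    lintegral_profilePlan _ _ hc, lintegral_profilePlan_snd _ _ hL]
  exact add_le_add le_rfl (interaction_sndMarginal_le hH hγ K)

end Profile

/-! ### Existence of minimizers, compactness and the lower bound -/

section Topology

theorem continuous_sndMarginal {X Y : Type*} [TopologicalSpace X] [MeasurableSpace X]
    [OpensMeasurableSpace X] [TopologicalSpace Y] [SecondCountableTopology Y] [MeasurableSpace Y]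
    [BorelSpace Y] :
    Continuous (sndMarginal : ProbabilityMeasure (X × Y) → ProbabilityMeasure Y) :=
  ProbabilityMeasure.continuous_map continuous_snd

theorem lowerSemicontinuous_const_mul {E : Type*} [TopologicalSpace E] {f : E → ℝ≥0∞}
    (hf : LowerSemicontinuous f) {a : ℝ≥0∞} (ha : a ≠ ⊤) :
    LowerSemicontinuous fun e => a * f e :=
  (ENNReal.continuous_const_mul ha).comp_lowerSemicontinuous hf
    fun _ _ h => mul_le_mul_right h a

variable {X Y : Type*} [TopologicalSpace X]
  [TopologicalSpace Y] [PolishSpace Y] [MeasurableSpace Y] [BorelSpace Y]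
  {c : X × Y → ℝ≥0∞} {L : Y → ℝ≥0∞} {H : Y × Y → ℝ≥0∞}

theorem lowerSemicontinuous_interaction (hH : LowerSemicontinuous H) :
    LowerSemicontinuous fun p : ProbabilityMeasure Y × ProbabilityMeasure Y =>
      interaction H p.1 p.2 :=
  (lowerSemicontinuous_lintegral hH).comp ProbabilityMeasure.continuous_prod

theorem lowerSemicontinuous_profileEnergy {N : ℕ} (hN : 1 ≤ N) (hc : LowerSemicontinuous c)
    (hL : LowerSemicontinuous L) (hH : LowerSemicontinuous H) (x : Fin N → X) :
    LowerSemicontinuous (profileEnergy c L H x) := by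
  have hN0 : (N : ℝ≥0∞) ≠ 0 := by simp; omega
  refine LowerSemicontinuous.add (LowerSemicontinuous.add ?_ ?_) ?_
  · refine lowerSemicontinuous_const_mul (lowerSemicontinuous_sum fun i _ => ?_)
      (by simpa using Nat.one_le_iff_ne_zero.1 hN)
    exact (lowerSemicontinuous_lintegral (hc.comp (Continuous.prodMk_right (x i)))).comp
      (continuous_apply i)
  · refine lowerSemicontinuous_const_mul (lowerSemicontinuous_sum fun i _ => ?_)
      (by simpa using Nat.one_le_iff_ne_zero.1 hN)
    exact (lowerSemicontinuous_lintegral hL).comp (continuous_apply i)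
  · refine lowerSemicontinuous_const_mul (lowerSemicontinuous_sum fun i _ =>
      lowerSemicontinuous_sum fun j _ => (lowerSemicontinuous_interaction hH).comp
        (g := fun ν : Fin N → ProbabilityMeasure Y => (ν i, ν j))
        ((continuous_apply i).prodMk (continuous_apply j)))
        (by simpa using Nat.one_le_iff_ne_zero.1 hN)

theorem exists_forall_profileEnergy_le [Nonempty Y] {N : ℕ} (hN : 1 ≤ N)
    (hc : LowerSemicontinuous c)
    (hL : LowerSemicontinuous L) (hH : LowerSemicontinuous H)
    (hL_compact : ∀ r : ℝ≥0, 0 < r → IsCompact {y : Y | L y ≤ r}) (x : Fin N → X) :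
    ∃ ν, ∀ ν', profileEnergy c L H x ν ≤ profileEnergy c L H x ν' := by
  have hN0 : (N : ℝ≥0∞) ≠ 0 := by simp; omega
  by_cases hfin : ∃ ν₀, profileEnergy c L H x ν₀ < ⊤
  · obtain ⟨ν₀, hν₀⟩ := hfin
    obtain ⟨r, hr⟩ : ∃ r : ℝ≥0, (r : ℝ≥0∞) = N * profileEnergy c L H x ν₀ :=
      ⟨_, ENNReal.coe_toNNReal (ENNReal.mul_ne_top (by simp) hν₀.ne)⟩
    -- Each mean cost is at most `N` times the energy, so the profiles no worse than `ν₀` lie in a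
    -- product of compact sets.
    let K : Set (Fin N → ProbabilityMeasure Y) := Set.univ.pi fun _ => {ν | meanCost L ν ≤ r}
    have hK : IsCompact K :=
      isCompact_univ_pi fun _ => isCompact_setOf_lintegral_le hL hL_compact r
    have hmem : ∀ ν, profileEnergy c L H x ν ≤ profileEnergy c L H x ν₀ → ν ∈ K := by
      intro ν hν i _
      have h1 : (N : ℝ≥0∞)⁻¹ * ∑ i, meanCost L (ν i) ≤ profileEnergy c L H x ν₀ := by
        refine le_trans ?_ hν
        rw [profileEnergy]
        exact le_add_right le_add_self
      change meanCost L (ν i) ≤ r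
      rw [hr]
      calc meanCost L (ν i) ≤ ∑ i, meanCost L (ν i) :=
            Finset.single_le_sum (f := fun i => meanCost L (ν i)) (fun _ _ => zero_le)
              (Finset.mem_univ i)
        _ = N * ((N : ℝ≥0∞)⁻¹ * ∑ i, meanCost L (ν i)) := by
            rw [← mul_assoc, ENNReal.mul_inv_cancel hN0 (by simp), one_mul]
        _ ≤ _ := mul_le_mul_right h1 _
    obtain ⟨ν, -, hν⟩ := LowerSemicontinuousOn.exists_isMinOn (s := K) ⟨ν₀, hmem ν₀ le_rfl⟩ hK
      ((lowerSemicontinuous_profileEnergy hN hc hL hH x).lowerSemicontinuousOn _)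
    refine ⟨ν, fun ν' => ?_⟩
    rcases le_total (profileEnergy c L H x ν') (profileEnergy c L H x ν₀) with h | h
    · exact hν (hmem ν' h)
    · exact (hν (hmem ν₀ le_rfl)).trans h
  · push Not at hfin
    exact ⟨fun _ => diracProba (Classical.arbitrary Y), fun ν' => le_top.trans (hfin ν')⟩

variable [MeasurableSpace X] [BorelSpace X]

theorem exists_isClosedLoopMinimizer [Nonempty Y] {N : ℕ} (hN : 1 ≤ N) (hc : LowerSemicontinuous c)
    (hL : LowerSemicontinuous L) (hH : LowerSemicontinuous H)
    (hL_compact : ∀ r : ℝ≥0, 0 < r → IsCompact {y : Y | L y ≤ r}) (x : Fin N → X) :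
    ∃ γ : ProbabilityMeasure (X × Y), IsClosedLoopMinimizer c L H x γ := by
  obtain ⟨ν, hν⟩ := exists_forall_profileEnergy_le hN hc hL hH hL_compact x
  obtain ⟨γ, hγ⟩ : ∃ γ : ProbabilityMeasure (X × Y), (γ : Measure (X × Y)) = profilePlan x ν :=
    ⟨⟨profilePlan x ν, isProbabilityMeasure_profilePlan hN x ν⟩, rfl⟩
  refine ⟨γ, fun γ' => ?_⟩
  rw [closedLoopPotential_eq hc.measurable, closedLoopPotential_eq hc.measurable]
  refine le_iInf₂ fun ν' _ => (iInf₂_le ν hγ).trans (hν ν')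

theorem isTightMeasureSet_of_isCompact_closure_of_polish {E : Type*} [TopologicalSpace E]
    [PolishSpace E] [MeasurableSpace E] [BorelSpace E] {S : Set (ProbabilityMeasure E)}
    (h : IsCompact (closure S)) :
    IsTightMeasureSet {((ν : ProbabilityMeasure E) : Measure E) | ν ∈ S} := by
  let := TopologicalSpace.upgradeIsCompletelyMetrizable E
  exact isTightMeasureSet_of_isCompact_closure h

variable [PolishSpace X]

/-- Tight marginals make the plans tight: the first marginals converge and the second ones have
bounded mean cost. -/
theorem exists_subseq_tendsto_of_marginals {μ : ProbabilityMeasure X}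
    (hL : LowerSemicontinuous L)
    (hL_compact : ∀ r : ℝ≥0, 0 < r → IsCompact {y : Y | L y ≤ r})
    {γ : ℕ → ProbabilityMeasure (X × Y)}
    (hfst : Tendsto (fun n => (γ n).map measurable_fst.aemeasurable) atTop (𝓝 μ)) {r : ℝ≥0}
    (hsnd : ∀ n, meanCost L (sndMarginal (γ n)) ≤ r) :
    ∃ (ψ : ℕ → ℕ) (γ' : ProbabilityMeasure (X × Y)), StrictMono ψ ∧
      Tendsto (γ ∘ ψ) atTop (𝓝 γ') ∧ γ' ∈ plansOver Y μ := by
  have h1 : IsCompact (closure (Set.range fun n => (γ n).map measurable_fst.aemeasurable)) :=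
    hfst.isCompact_insert_range.closure_of_subset (Set.subset_insert _ _)
  have h2 : IsCompact (closure (Set.range fun n => sndMarginal (γ n))) :=
    (isCompact_setOf_lintegral_le hL hL_compact r).closure_of_subset (by
      rintro _ ⟨n, rfl⟩
      exact hsnd n)
  have htight : IsTightMeasureSet {((ρ : ProbabilityMeasure (X × Y)) : Measure (X × Y)) |
      ρ ∈ Set.range γ} := by
    refine IsTightMeasureSet.prodMk ?_ ?_
    · refine (isTightMeasureSet_of_isCompact_closure_of_polish h1).subset ?_
      rintro _ ⟨_, ⟨_, ⟨n, rfl⟩, rfl⟩, rfl⟩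
      exact ⟨(γ n).map measurable_fst.aemeasurable, Set.mem_range_self n, rfl⟩
    · refine (isTightMeasureSet_of_isCompact_closure_of_polish h2).subset ?_
      rintro _ ⟨_, ⟨_, ⟨n, rfl⟩, rfl⟩, rfl⟩
      exact ⟨sndMarginal (γ n), Set.mem_range_self n, rfl⟩
  obtain ⟨γ', -, ψ, hψ, hlim⟩ := (isCompact_closure_of_isTightMeasureSet htight).tendsto_subseq
    fun n => subset_closure (Set.mem_range_self n)
  refine ⟨ψ, γ', hψ, hlim, ?_⟩
  have h3 := ProbabilityMeasure.tendsto_map_of_tendsto_of_continuous _ _ hlim continuous_fst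
  have h4 := tendsto_nhds_unique h3 (hfst.comp hψ.tendsto_atTop)
  exact congrArg (fun ρ : ProbabilityMeasure X => (ρ : Measure X)) h4

theorem le_of_tendsto_of_lowerSemicontinuous {E : Type*} [TopologicalSpace E] {G : E → ℝ≥0∞}
    (hG : LowerSemicontinuous G) {u : ℕ → E} {e : E} (hu : Tendsto u atTop (𝓝 e))
    {a : ℕ → ℝ≥0∞} {ℓ : ℝ≥0∞} (ha : Tendsto a atTop (𝓝 ℓ)) (hle : ∀ n, G (u n) ≤ a n) :
    G e ≤ ℓ := by
  by_contra h
  obtain ⟨b, hb, hb'⟩ := exists_between (not_le.1 h)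
  obtain ⟨n, h1, h2⟩ := ((hu.eventually (hG e b hb')).and (ha.eventually_lt_const hb)).exists
  exact absurd (h1.trans_le (hle n)) (not_lt.2 h2.le)

/-- The compactness and lower-bound half of the variational limit. For fixed truncation `k` the
error `k/N` vanishes as `N → ∞`; only afterwards is the supremum over `k` taken. -/
theorem exists_subseq_tendsto_of_profileEnergy_le {μ : ProbabilityMeasure X}
    (hc : LowerSemicontinuous c) (hL : LowerSemicontinuous L) (hH : LowerSemicontinuous H)
    (hL_compact : ∀ r : ℝ≥0, 0 < r → IsCompact {y : Y | L y ≤ r})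
    {x : ℕ → X} (hx : Tendsto (empirical x) atTop (𝓝 μ)) {φ : ℕ → ℕ} (hφ : StrictMono φ)
    {ν : ∀ n, Fin (φ n + 1) → ProbabilityMeasure Y} {γ : ℕ → ProbabilityMeasure (X × Y)}
    (hγ : ∀ n, (γ n : Measure (X × Y)) = profilePlan (fun i : Fin (φ n + 1) => x i) (ν n))
    {ℓ : ℝ≥0} {ε : ℕ → ℝ≥0} (hε : Tendsto ε atTop (𝓝 0))
    (hE : ∀ n, profileEnergy c L H (fun i : Fin (φ n + 1) => x i) (ν n) ≤ ℓ + ε n) :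
    ∃ (ψ : ℕ → ℕ) (γ' : ProbabilityMeasure (X × Y)), StrictMono ψ ∧
      Tendsto (γ ∘ ψ) atTop (𝓝 γ') ∧ γ' ∈ plansOver Y μ ∧ limitPotential c L H μ γ' ≤ ℓ := by
  have hfst_lim : Tendsto (fun n => (γ n).map measurable_fst.aemeasurable) atTop (𝓝 μ) := by
    simp only [fun n => map_fst_eq_empirical (hγ n)]
    exact hx.comp hφ.tendsto_atTop
  obtain ⟨r, hr⟩ : ∃ r, ∀ n, ε n ≤ r := by
    obtain ⟨r, hr⟩ := hε.bddAbove_range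
    exact ⟨r, fun n => hr ⟨n, rfl⟩⟩
  have hmean : ∀ n, meanCost L (sndMarginal (γ n)) ≤ ((ℓ + r : ℝ≥0) : ℝ≥0∞) := by
    intro n
    -- Truncation at height `0` suffices here, since only the bound on the mean cost is wanted.
    have h1 := truncated_energy_le hc.measurable hL.measurable hH.measurable (hγ n) 0
    rw [ENNReal.coe_zero, mul_zero, add_zero] at h1
    calc _ ≤ _ := le_add_right le_add_self
      _ ≤ profileEnergy c L H (fun i : Fin (φ n + 1) => x i) (ν n) := h1
      _ ≤ ℓ + ε n := hE n
      _ ≤ _ := by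
          push_cast
          exact add_le_add le_rfl (by exact_mod_cast hr n)
  obtain ⟨ψ, γ', hψ, hlim, hγ'⟩ := exists_subseq_tendsto_of_marginals hL hL_compact hfst_lim hmean
  refine ⟨ψ, γ', hψ, hlim, hγ', ?_⟩
  rw [limitPotential, if_pos hγ', ← iSup_interaction_min hH.measurable, ENNReal.add_iSup]
  refine iSup_le fun k => ?_
  have hG : LowerSemicontinuous fun ρ : ProbabilityMeasure (X × Y) =>
      ∫⁻ z, c z ∂(ρ : Measure (X × Y)) + meanCost L (sndMarginal ρ)
        + interaction (fun z => min (H z) ((k : ℝ≥0) : ℝ≥0∞)) (sndMarginal ρ) (sndMarginal ρ) :=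
    ((lowerSemicontinuous_lintegral hc).add
      ((lowerSemicontinuous_lintegral hL).comp continuous_sndMarginal)).add
      ((lowerSemicontinuous_interaction (hH.inf lowerSemicontinuous_const)).comp
        (g := fun ρ : ProbabilityMeasure (X × Y) => (sndMarginal ρ, sndMarginal ρ))
        (continuous_sndMarginal.prodMk continuous_sndMarginal))
  have hlimit : Tendsto (fun n => (ℓ : ℝ≥0∞) + ε (ψ n) +
      ((φ (ψ n) + 1 : ℕ) : ℝ≥0∞)⁻¹ * (k : ℝ≥0)) atTop (𝓝 (ℓ + 0 + 0 * (k : ℝ≥0))) := by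
    refine Tendsto.add (Tendsto.add tendsto_const_nhds ?_) ?_
    · exact ENNReal.tendsto_coe.2 (hε.comp hψ.tendsto_atTop)
    · refine ENNReal.Tendsto.mul_const ?_ (Or.inr ENNReal.coe_ne_top)
      exact ENNReal.tendsto_inv_nat_nhds_zero.comp ((tendsto_add_atTop_nat 1).comp
        (hφ.tendsto_atTop.comp hψ.tendsto_atTop))
  simp only [zero_mul, add_zero] at hlimit
  refine le_of_tendsto_of_lowerSemicontinuous hG hlim hlimit fun n => ?_
  exact (truncated_energy_le hc.measurable hL.measurable hH.measurable (hγ (ψ n)) k).trans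
    (add_le_add (hE _) le_rfl)

end Topology

/-! ### The potential structure of the closed-loop game -/

section Nash

variable {X Y : Type*} [MeasurableSpace Y] {N : ℕ}
  {c : X × Y → ℝ≥0∞} {L : Y → ℝ≥0∞} {H : Y × Y → ℝ≥0∞}

theorem sum_sum_ne_eq {a : Fin N → Fin N → ℝ≥0∞} (ha : ∀ i j, a i j = a j i) (i : Fin N) :
    ∑ j, ∑ k with k ≠ j, a j k
      = 2 * ∑ j with j ≠ i, a i j + ∑ j with j ≠ i, ∑ k with k ≠ j ∧ k ≠ i, a j k := by
  have h : ∀ j ∈ Finset.univ.filter (· ≠ i), ∑ k with k ≠ j, a j k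
      = ∑ k with k ≠ j ∧ k ≠ i, a j k + a i j := by
    intro j hj
    rw [← Finset.sum_filter_add_sum_filter_not (Finset.univ.filter (· ≠ j)) (· ≠ i),
      Finset.filter_filter, ha i j]
    congr 1
    rw [Finset.filter_filter]
    have : (Finset.univ.filter fun k => k ≠ j ∧ ¬ k ≠ i) = {i} := by
      ext k
      simp only [Finset.mem_filter, Finset.mem_univ, true_and, not_not, Finset.mem_singleton]
      refine ⟨fun h => h.2, fun h => ⟨?_, h⟩⟩
      rw [h]
      exact (Finset.mem_filter.1 hj).2.symm
    rw [this, Finset.sum_singleton]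
  rw [sum_eq_sum_ne_add _ i, Finset.sum_congr rfl h, Finset.sum_add_distrib]
  ring

/-- Every pair containing `i` occurs twice in the double sum, whence the factor `2/N` in the
individual cost. The remainder does not involve `ν i`. -/
theorem profileEnergy_eq (hH : Measurable H) (hH_symm : ∀ y y', H (y, y') = H (y', y))
    (x : Fin N → X) (i : Fin N) (ν : Fin N → ProbabilityMeasure Y) :
    profileEnergy c L H x ν = (N : ℝ≥0∞)⁻¹ * closedLoopCost c L H x i ν +
      ((N : ℝ≥0∞)⁻¹ * ∑ j with j ≠ i, ∫⁻ y, c (x j, y) ∂(ν j : Measure Y)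
        + (N : ℝ≥0∞)⁻¹ * ∑ j with j ≠ i, meanCost L (ν j)
        + ((N : ℝ≥0∞) ^ 2)⁻¹ *
          ∑ j with j ≠ i, ∑ k with k ≠ j ∧ k ≠ i, interaction H (ν j) (ν k)) := by
  rw [profileEnergy, closedLoopCost,
    sum_sum_ne_eq (fun j k => interaction_comm hH hH_symm (ν j) (ν k)) i,
    sum_eq_sum_ne_add (fun j => ∫⁻ y, c (x j, y) ∂(ν j : Measure Y)) i,
    sum_eq_sum_ne_add (fun j => meanCost L (ν j)) i, sq,
    ENNReal.mul_inv (Or.inr (ENNReal.natCast_ne_top _)) (Or.inl (ENNReal.natCast_ne_top _)),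
    div_eq_mul_inv]
  ring

theorem isNashEquilibrium_of_forall_le (hH : Measurable H)
    (hH_symm : ∀ y y', H (y, y') = H (y', y)) {x : Fin N → X} {ν : Fin N → ProbabilityMeasure Y}
    (hfin : profileEnergy c L H x ν < ⊤)
    (hmin : ∀ ν', profileEnergy c L H x ν ≤ profileEnergy c L H x ν') :
    IsNashEquilibrium (closedLoopCost c L H x) ν := by
  intro i s
  have hN : (N : ℝ≥0∞)⁻¹ ≠ 0 := ENNReal.inv_ne_zero.2 (ENNReal.natCast_ne_top _)
  have hN' : (N : ℝ≥0∞)⁻¹ ≠ ⊤ := ENNReal.inv_ne_top.2 (by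
    have := i.pos
    simp
    omega)
  have h := hmin (Function.update ν i s)
  have hu : ∀ j, j ≠ i → Function.update ν i s j = ν j := fun j hj =>
    Function.update_of_ne hj _ _
  rw [profileEnergy_eq hH hH_symm x i] at hfin
  rw [profileEnergy_eq hH hH_symm x i, profileEnergy_eq hH hH_symm x i (Function.update ν i s)] at h
  have e1 : ∑ j with j ≠ i, ∫⁻ y, c (x j, y) ∂(Function.update ν i s j : Measure Y)
      = ∑ j with j ≠ i, ∫⁻ y, c (x j, y) ∂(ν j : Measure Y) :=
    Finset.sum_congr rfl fun j hj => by rw [hu j (Finset.mem_filter.1 hj).2]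
  have e2 : ∑ j with j ≠ i, meanCost L (Function.update ν i s j)
      = ∑ j with j ≠ i, meanCost L (ν j) :=
    Finset.sum_congr rfl fun j hj => by rw [hu j (Finset.mem_filter.1 hj).2]
  have e3 : ∑ j with j ≠ i, ∑ k with k ≠ j ∧ k ≠ i,
        interaction H (Function.update ν i s j) (Function.update ν i s k)
      = ∑ j with j ≠ i, ∑ k with k ≠ j ∧ k ≠ i, interaction H (ν j) (ν k) :=
    Finset.sum_congr rfl fun j hj => Finset.sum_congr rfl fun k hk => by
      rw [hu j (Finset.mem_filter.1 hj).2, hu k (Finset.mem_filter.1 hk).2.2]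
  rw [e1, e2, e3] at h
  -- Finite energy is what allows the common remainder to be cancelled.
  have h1 := (ENNReal.add_le_add_iff_right (ENNReal.add_lt_top.1 hfin).2.ne).1 h
  exact (ENNReal.mul_le_mul_iff_right hN hN').1 h1

variable [MeasurableSpace X]

theorem profilePlan_injective [MeasurableSingletonClass X] {x : Fin N → X}
    (hx : Function.Injective x) :
    Function.Injective (profilePlan (Y := Y) x) := by
  intro ν ν' h
  funext i
  apply Subtype.ext
  have hN : (N : ℝ≥0∞)⁻¹ ≠ 0 := ENNReal.inv_ne_zero.2 (ENNReal.natCast_ne_top _)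
  have hN' : (N : ℝ≥0∞)⁻¹ ≠ ⊤ := ENNReal.inv_ne_top.2 (by
    have := i.pos
    simp
    omega)
  ext B hB
  have key : ∀ ν : Fin N → ProbabilityMeasure Y,
      profilePlan x ν ({x i} ×ˢ B) = (N : ℝ≥0∞)⁻¹ * (ν i : Measure Y) B := by
    intro ν
    rw [profilePlan, Measure.smul_apply, Measure.finsetSum_apply, smul_eq_mul]
    congr 1
    rw [Finset.sum_eq_single i]
    · simp [Measure.prod_prod]
    · intro j _ hj
      rw [Measure.prod_prod, Measure.dirac_apply' _ (measurableSet_singleton _),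
        Set.indicator_of_notMem (s := {x i}) (a := x j) (fun h => hj (hx h)), zero_mul]
    · simp
  have h1 := congrArg (fun m : Measure (X × Y) => m ({x i} ×ˢ B)) h
  simp only [key] at h1
  exact (ENNReal.mul_right_inj hN hN').1 h1

/-- A profile of finite energy forces the infimum defining the potential of `γ` to run over a
nonempty set, and distinct types make the profile unique. -/
theorem IsClosedLoopMinimizer.exists_profile [MeasurableSingletonClass X] (hc : Measurable c)
    (hN : 1 ≤ N) {x : Fin N → X} (hx : Function.Injective x) {γ : ProbabilityMeasure (X × Y)}
    (hγ : IsClosedLoopMinimizer c L H x γ) {ν₀ : Fin N → ProbabilityMeasure Y}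
    (hν₀ : profileEnergy c L H x ν₀ < ⊤) :
    ∃ ν : Fin N → ProbabilityMeasure Y, (γ : Measure (X × Y)) = profilePlan x ν ∧
      ∀ ν', profileEnergy c L H x ν ≤ profileEnergy c L H x ν' := by
  have hle : ∀ ν', closedLoopPotential c L H x γ ≤ profileEnergy c L H x ν' := by
    intro ν'
    obtain ⟨γ', hγ'⟩ : ∃ γ' : ProbabilityMeasure (X × Y),
        (γ' : Measure (X × Y)) = profilePlan x ν' :=
      ⟨⟨profilePlan x ν', isProbabilityMeasure_profilePlan hN x ν'⟩, rfl⟩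
    refine (hγ γ').trans ?_
    rw [closedLoopPotential_eq hc]
    exact iInf₂_le ν' hγ'
  have hlt := (hle ν₀).trans_lt hν₀
  rw [closedLoopPotential_eq hc, iInf_lt_iff] at hlt
  obtain ⟨ν, hlt⟩ := hlt
  obtain ⟨hν, -⟩ := iInf_lt_iff.1 hlt
  refine ⟨ν, hν, fun ν' => le_trans ?_ (hle ν')⟩
  rw [closedLoopPotential_eq hc]
  refine le_iInf₂ fun ν'' h'' => ?_
  rw [profilePlan_injective hx (hν.symm.trans h'')]

end Nash
-- The right-hand side is a quadratic in `t` that equals the left-hand side at `t = 0`; the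
-- conclusion says that its right derivative there is nonnegative.
theorem le_of_forall_quadratic_le {e a f b d : ℝ≥0}
    (h : ∀ s t : ℝ≥0, s + t = 1 →
      e + a ≤ s * e + t * f + (s ^ 2 * a + 2 * s * t * b + t ^ 2 * d)) :
    e + 2 * a ≤ f + 2 * b := by
  rw [← NNReal.coe_le_coe]
  push_cast
  by_contra hlt
  push Not at hlt
  have hM : (0 : ℝ) < a + d + 1 := by positivity
  set D : ℝ := e + 2 * a - (f + 2 * b) with hD
  have hD0 : 0 < D := by linarith
  -- So small that the quadratic term, at most `t * (a + d)` after division by `t`, cannot offset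
  -- the supposed negative slope `-D`.
  set t : ℝ := min 1 (D / (2 * (a + d + 1))) with ht
  have ht0 : 0 < t := lt_min one_pos (by positivity)
  have ht1 : t ≤ 1 := min_le_left _ _
  have ht2 : t * (a + d + 1) ≤ D / 2 := by
    have : t ≤ D / (2 * (a + d + 1)) := min_le_right _ _
    rw [le_div_iff₀ (by positivity)] at this
    linarith
  have h1 := h ⟨1 - t, by linarith⟩ ⟨t, ht0.le⟩ (NNReal.eq (sub_add_cancel 1 t))
  rw [← NNReal.coe_le_coe] at h1
  push_cast at h1
  change (e : ℝ) + a ≤ (1 - t) * e + t * f + ((1 - t) ^ 2 * a + 2 * (1 - t) * t * b + t ^ 2 * d)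
    at h1
  have h2 : 0 ≤ t * (-D + t * (a + d - 2 * b)) := by
    have : t * (-D + t * (a + d - 2 * b))
        = (1 - t) * e + t * f + ((1 - t) ^ 2 * a + 2 * (1 - t) * t * b + t ^ 2 * d) - (e + a) := by
      rw [hD]; ring
    linarith
  have h3 : 0 ≤ -D + t * (a + d - 2 * b) := nonneg_of_mul_nonneg_right h2 ht0
  have h4 : 0 ≤ t * (b : ℝ) := by positivity
  nlinarith

/-! ### First-order conditions for minimizers of the limit potential -/

section MeanField

variable {X Y : Type*} [MeasurableSpace X] [MeasurableSpace Y]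
  {c : X × Y → ℝ≥0∞} {L : Y → ℝ≥0∞} {H : Y × Y → ℝ≥0∞}

theorem measurable_meanFieldCost (hc : Measurable c) (hL : Measurable L) (hH : Measurable H)
    (ν : ProbabilityMeasure Y) : Measurable fun z : X × Y => meanFieldCost c L H z.1 z.2 ν := by
  have h : Measurable fun y => ∫⁻ y', H (y, y') ∂(ν : Measure Y) := hH.lintegral_prod_right'
  unfold meanFieldCost
  fun_prop

theorem lintegral_meanFieldCost (hc : Measurable c) (hL : Measurable L) (hH : Measurable H)
    (γ : ProbabilityMeasure (X × Y)) (ν : ProbabilityMeasure Y) :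
    ∫⁻ z, meanFieldCost c L H z.1 z.2 ν ∂(γ : Measure (X × Y))
      = ∫⁻ z, c z ∂(γ : Measure (X × Y)) + meanCost L (sndMarginal γ)
        + 2 * interaction H (sndMarginal γ) ν := by
  have h : Measurable fun y => ∫⁻ y', H (y, y') ∂(ν : Measure Y) := hH.lintegral_prod_right'
  unfold meanFieldCost
  rw [lintegral_add_left (by fun_prop), lintegral_add_left (by fun_prop),
    lintegral_const_mul _ (by fun_prop), meanCost, lintegral_sndMarginal _ hL,
    interaction_eq_lintegral hH, lintegral_sndMarginal _ h]

theorem limitPotential_of_mem {μ : ProbabilityMeasure X} {γ : ProbabilityMeasure (X × Y)}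
    (hγ : γ ∈ plansOver Y μ) :
    limitPotential c L H μ γ = ∫⁻ z, c z ∂(γ : Measure (X × Y)) + meanCost L (sndMarginal γ)
      + interaction H (sndMarginal γ) (sndMarginal γ) := if_pos hγ

/-- The potential is compared with its value on the segment from `γ` to `γ'`, where it is quadratic.
Finite self-interaction of `γ'` keeps the second-order coefficient finite. -/
theorem lintegral_meanFieldCost_le (hc : Measurable c) (hL : Measurable L) (hH : Measurable H)
    (hH_symm : ∀ y y', H (y, y') = H (y', y)) {μ : ProbabilityMeasure X}
    {γ γ' : ProbabilityMeasure (X × Y)} (hγ : γ ∈ plansOver Y μ)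
    (hfin : limitPotential c L H μ γ < ⊤)
    (hmin : ∀ ρ ∈ plansOver Y μ, limitPotential c L H μ γ ≤ limitPotential c L H μ ρ)
    (hγ' : γ' ∈ plansOver Y μ)
    (hfin' : interaction H (sndMarginal γ') (sndMarginal γ') ≠ ⊤) :
    ∫⁻ z, meanFieldCost c L H z.1 z.2 (sndMarginal γ) ∂(γ : Measure (X × Y))
      ≤ ∫⁻ z, meanFieldCost c L H z.1 z.2 (sndMarginal γ) ∂(γ' : Measure (X × Y)) := by
  by_cases htop : ∫⁻ z, meanFieldCost c L H z.1 z.2 (sndMarginal γ) ∂(γ' : Measure (X × Y)) = ⊤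
  · rw [htop]
    exact le_top
  rw [lintegral_meanFieldCost hc hL hH] at htop
  rw [lintegral_meanFieldCost hc hL hH, lintegral_meanFieldCost hc hL hH]
  rw [limitPotential_of_mem hγ] at hfin hmin
  set ν := sndMarginal γ with hν
  set ν' := sndMarginal γ' with hν'
  have he : ∫⁻ z, c z ∂(γ : Measure (X × Y)) + meanCost L ν ≠ ⊤ :=
    (ENNReal.add_lt_top.1 hfin).1.ne
  have ha : interaction H ν ν ≠ ⊤ := (ENNReal.add_lt_top.1 hfin).2.ne
  have hf : ∫⁻ z, c z ∂(γ' : Measure (X × Y)) + meanCost L ν' ≠ ⊤ :=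
    (ENNReal.add_lt_top.1 (lt_top_iff_ne_top.2 htop)).1.ne
  have hb : interaction H ν' ν ≠ ⊤ := fun h => htop (by rw [h]; simp)
  have key : ∀ s t : ℝ≥0, s + t = 1 →
      ∫⁻ z, c z ∂(γ : Measure (X × Y)) + meanCost L ν + interaction H ν ν
        ≤ s * (∫⁻ z, c z ∂(γ : Measure (X × Y)) + meanCost L ν)
          + t * (∫⁻ z, c z ∂(γ' : Measure (X × Y)) + meanCost L ν')
          + (s ^ 2 * interaction H ν ν + 2 * s * t * interaction H ν' ν
            + t ^ 2 * interaction H ν' ν') := by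
    intro s t hst
    have hst' : (s : ℝ≥0∞) + t = 1 := by exact_mod_cast hst
    obtain ⟨ρ, hρ⟩ : ∃ ρ : ProbabilityMeasure (X × Y),
        (ρ : Measure (X × Y))
          = (s : ℝ≥0∞) • (γ : Measure (X × Y)) + (t : ℝ≥0∞) • (γ' : Measure (X × Y)) :=
      ⟨⟨(s : ℝ≥0∞) • (γ : Measure (X × Y)) + (t : ℝ≥0∞) • (γ' : Measure (X × Y)), ⟨by simp [hst']⟩⟩,
        rfl⟩
    have hρ_int : ∀ g : X × Y → ℝ≥0∞, ∫⁻ z, g z ∂(ρ : Measure (X × Y))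
        = s * ∫⁻ z, g z ∂(γ : Measure (X × Y)) + t * ∫⁻ z, g z ∂(γ' : Measure (X × Y)) := by
      intro g
      rw [hρ, lintegral_add_measure, lintegral_smul_measure, lintegral_smul_measure, smul_eq_mul,
        smul_eq_mul]
    have hρ_snd : ∀ g : Y → ℝ≥0∞, Measurable g → ∫⁻ y, g y ∂(sndMarginal ρ : Measure Y)
        = s * ∫⁻ y, g y ∂(ν : Measure Y) + t * ∫⁻ y, g y ∂(ν' : Measure Y) := fun g hg => by
      rw [lintegral_sndMarginal _ hg, hρ_int, lintegral_sndMarginal _ hg,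
        lintegral_sndMarginal _ hg]
    have hρ_mem : ρ ∈ plansOver Y μ := by
      change (ρ : Measure (X × Y)).map Prod.fst = (μ : Measure X)
      rw [hρ, Measure.map_add _ _ measurable_fst, Measure.map_smul, Measure.map_smul,
        show (γ : Measure (X × Y)).map Prod.fst = (μ : Measure X) from hγ,
        show (γ' : Measure (X × Y)).map Prod.fst = (μ : Measure X) from hγ', ← add_smul, hst',
        one_smul]
    refine (hmin ρ hρ_mem).trans (le_of_eq ?_)
    have hm : ∀ ρ' : ProbabilityMeasure Y, Measurable fun y => ∫⁻ y', H (y, y') ∂(ρ' : Measure Y) :=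
      fun ρ' => hH.lintegral_prod_right'
    have hI : ∀ ρ' : ProbabilityMeasure Y, interaction H (sndMarginal ρ) ρ'
        = s * interaction H ν ρ' + t * interaction H ν' ρ' := fun ρ' => by
      simp_rw [interaction_eq_lintegral hH]
      rw [hρ_snd _ (hm ρ')]
    rw [limitPotential_of_mem hρ_mem, hρ_int, meanCost, hρ_snd L hL, hI,
      interaction_comm hH hH_symm ν (sndMarginal ρ), interaction_comm hH hH_symm ν' (sndMarginal ρ),
      hI, hI, interaction_comm hH hH_symm ν ν']
    simp only [meanCost]
    ring
  generalize ∫⁻ z, c z ∂(γ : Measure (X × Y)) + meanCost L ν = e at *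
  generalize ∫⁻ z, c z ∂(γ' : Measure (X × Y)) + meanCost L ν' = f at *
  generalize interaction H ν ν = a at *
  generalize interaction H ν' ν = b at *
  generalize interaction H ν' ν' = d at *
  lift e to ℝ≥0 using he
  lift f to ℝ≥0 using hf
  lift a to ℝ≥0 using ha
  lift b to ℝ≥0 using hb
  lift d to ℝ≥0 using hfin'
  have := le_of_forall_quadratic_le (e := e) (f := f) (a := a) (b := b) (d := d)
    fun s t hst => by exact_mod_cast key s t hst
  exact_mod_cast this

/-- If switching to `η` were strictly better on a set of positive mass, redirecting the plan on that
set alone would contradict the first-order condition. The restriction to `g ≤ Φ` makes `g`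
integrable there, so that `hη` bounds the self-interaction of the redirected mass. -/
theorem ae_le_lintegral_kernel_of_minimizer (hc : Measurable c) (hL : Measurable L)
    (hH : Measurable H)
    (hH_symm : ∀ y y', H (y, y') = H (y', y)) {μ : ProbabilityMeasure X}
    {γ : ProbabilityMeasure (X × Y)} (hγ : γ ∈ plansOver Y μ)
    (hfin : limitPotential c L H μ γ < ⊤)
    (hmin : ∀ ρ ∈ plansOver Y μ, limitPotential c L H μ γ ≤ limitPotential c L H μ ρ)
    (η : Kernel X Y) [IsMarkovKernel η] {g : X → ℝ≥0∞} (hg : Measurable g) (C : ℝ≥0)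
    (hη : ∀ x x', ∫⁻ z, H z ∂((η x).prod (η x')) ≤ C * (1 + g x + g x')) :
    ∀ᵐ z ∂(γ : Measure (X × Y)),
      g z.1 ≤ meanFieldCost c L H z.1 z.2 (sndMarginal γ) →
        meanFieldCost c L H z.1 z.2 (sndMarginal γ)
          ≤ ∫⁻ w, meanFieldCost c L H z.1 w (sndMarginal γ) ∂(η z.1) := by
  set ν := sndMarginal γ with hν
  set Φ : X × Y → ℝ≥0∞ := fun z => meanFieldCost c L H z.1 z.2 ν with hΦ
  have hΦ_meas : Measurable Φ := measurable_meanFieldCost hc hL hH ν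
  set Ψ : X × Y → ℝ≥0∞ := fun z => ∫⁻ w, Φ (z.1, w) ∂(η z.1) with hΨ
  have hΨ_meas : Measurable Ψ :=
    (hΦ_meas.lintegral_kernel_prod_right' (κ := η)).comp measurable_fst
  set A : Set (X × Y) := {z | g z.1 ≤ Φ z ∧ Ψ z < Φ z} with hA_def
  have hA : MeasurableSet A :=
    (measurableSet_le (hg.comp measurable_fst) hΦ_meas).inter
      (measurableSet_lt hΨ_meas hΦ_meas)
  suffices h0 : (γ : Measure (X × Y)) A = 0 by
    rw [ae_iff]
    convert h0 using 2
    ext z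
    simp [A, Φ, Ψ]
  by_contra h0
  have hΦ_fin : ∫⁻ z, Φ z ∂(γ : Measure (X × Y)) ≠ ⊤ := by
    rw [limitPotential_of_mem hγ] at hfin
    rw [hΦ, lintegral_meanFieldCost hc hL hH]
    have h1 := ENNReal.add_lt_top.1 hfin
    exact ENNReal.add_ne_top.2 ⟨h1.1.ne, ENNReal.mul_ne_top (by simp) h1.2.ne⟩
  set α : Measure X := ((γ : Measure (X × Y)).restrict A).map Prod.fst with hα
  have hτ_int : ∀ f : X × Y → ℝ≥0∞, Measurable f → ∫⁻ z, f z ∂(α ⊗ₘ η)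
      = ∫⁻ z in A, ∫⁻ w, f (z.1, w) ∂(η z.1) ∂(γ : Measure (X × Y)) := fun f hf => by
    rw [Measure.lintegral_compProd hf, hα,
      lintegral_map hf.lintegral_kernel_prod_right' measurable_fst]
  have hint : ∀ f : X × Y → ℝ≥0∞, Measurable f →
      ∫⁻ z, f z ∂((γ : Measure (X × Y)).restrict Aᶜ + α ⊗ₘ η)
        = ∫⁻ z in Aᶜ, f z ∂(γ : Measure (X × Y))
          + ∫⁻ z in A, ∫⁻ w, f (z.1, w) ∂(η z.1) ∂(γ : Measure (X × Y)) := fun f hf => by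
    rw [lintegral_add_measure, hτ_int f hf]
  have hfst : ((γ : Measure (X × Y)).restrict Aᶜ + α ⊗ₘ η).map Prod.fst = (μ : Measure X) := by
    ext s hs
    have hs' : Measurable (s.indicator (1 : X → ℝ≥0∞)) := measurable_one.indicator hs
    rw [← lintegral_indicator_one hs, lintegral_map hs' measurable_fst,
      hint (fun z => s.indicator 1 z.1) (hs'.comp measurable_fst)]
    simp only [lintegral_const, measure_univ, mul_one]
    rw [add_comm, lintegral_add_compl _ hA,
      ← lintegral_map (f := s.indicator 1) hs' measurable_fst,
      show (γ : Measure (X × Y)).map Prod.fst = (μ : Measure X) from hγ, lintegral_indicator_one hs]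
  obtain ⟨ρ, hρ⟩ : ∃ ρ : ProbabilityMeasure (X × Y),
      (ρ : Measure (X × Y)) = (γ : Measure (X × Y)).restrict Aᶜ + α ⊗ₘ η := by
    refine ⟨⟨(γ : Measure (X × Y)).restrict Aᶜ + α ⊗ₘ η, ⟨?_⟩⟩, rfl⟩
    have h1 := congrArg (fun m : Measure X => m Set.univ) hfst
    simpa [Measure.map_apply measurable_fst] using h1
  have hρ_mem : ρ ∈ plansOver Y μ := by
    change (ρ : Measure (X × Y)).map Prod.fst = (μ : Measure X)
    rw [hρ, hfst]
  have hΨ_fin : ∫⁻ z in A, Ψ z ∂(γ : Measure (X × Y)) < ∫⁻ z in A, Φ z ∂(γ : Measure (X × Y)) := by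
    refine setLIntegral_strict_mono hA h0 hΦ_meas ?_ ?_
    · refine ne_top_of_le_ne_top hΦ_fin (le_trans ?_ (setLIntegral_le_lintegral A Φ))
      exact setLIntegral_mono' hA fun z hz => hz.2.le
    · exact Eventually.of_forall fun z hz => hz.2
  have hlt : ∫⁻ z, Φ z ∂(ρ : Measure (X × Y)) < ∫⁻ z, Φ z ∂(γ : Measure (X × Y)) := by
    have hAc : ∫⁻ z in Aᶜ, Φ z ∂(γ : Measure (X × Y)) ≠ ⊤ :=
      ne_top_of_le_ne_top hΦ_fin (setLIntegral_le_lintegral _ _)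
    calc ∫⁻ z, Φ z ∂(ρ : Measure (X × Y))
        = ∫⁻ z in A, Ψ z ∂(γ : Measure (X × Y)) + ∫⁻ z in Aᶜ, Φ z ∂(γ : Measure (X × Y)) := by
          rw [hρ, hint Φ hΦ_meas, add_comm]
      _ < ∫⁻ z in A, Φ z ∂(γ : Measure (X × Y)) + ∫⁻ z in Aᶜ, Φ z ∂(γ : Measure (X × Y)) :=
          ENNReal.add_lt_add_right hAc hΨ_fin
      _ = _ := lintegral_add_compl Φ hA
  refine absurd (lintegral_meanFieldCost_le hc hL hH hH_symm hγ hfin hmin hρ_mem ?_) (not_le.2 hlt)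
  -- The new second marginal splits into the kept part `σ ≤ ν` and the redirected part `τ`. The
  -- admissibility of `ρ` reduces to the finiteness of four interactions.
  set σ : Measure Y := ((γ : Measure (X × Y)).restrict Aᶜ).map Prod.snd with hσ
  set τ : Measure Y := (α ⊗ₘ η).map Prod.snd with hτ
  have hsnd : (sndMarginal ρ : Measure Y) = σ + τ := by
    change (ρ : Measure (X × Y)).map Prod.snd = σ + τ
    rw [hρ, Measure.map_add _ _ measurable_snd]
  have hσν : σ ≤ (ν : Measure Y) := Measure.map_mono Measure.restrict_le_self measurable_snd
  have hτ' : ∀ f : Y → ℝ≥0∞, Measurable f → ∫⁻ y, f y ∂τ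
      = ∫⁻ z in A, ∫⁻ w, f w ∂(η z.1) ∂(γ : Measure (X × Y)) := fun f hf => by
    rw [hτ, lintegral_map hf measurable_snd, hτ_int (fun z => f z.2) (by fun_prop)]
  -- `Ψ` contains the interaction with `ν`, and its integral over `A` is finite since it is less
  -- than that of `Φ`.
  have hτν : ∫⁻ y, ∫⁻ y', H (y, y') ∂(ν : Measure Y) ∂τ < ⊤ := by
    rw [hτ' _ hH.lintegral_prod_right']
    refine lt_of_le_of_lt (lintegral_mono fun z => ?_) (hΨ_fin.trans_le le_top)
    refine lintegral_mono fun w => ?_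
    simp only [hΦ, meanFieldCost, two_mul]
    exact le_add_left le_self_add
  have hσm : Measurable fun y => ∫⁻ y', H (y, y') ∂σ := hH.lintegral_prod_right'
  have hτm : Measurable fun y => ∫⁻ y', H (y, y') ∂τ := hH.lintegral_prod_right'
  have hττ : ∫⁻ y, ∫⁻ y', H (y, y') ∂τ ∂τ < ⊤ := by
    rw [hτ' _ hτm]
    have h1 : ∀ z : X × Y, ∫⁻ y, ∫⁻ y', H (y, y') ∂τ ∂(η z.1)
        ≤ ∫⁻ z' in A, C * (1 + g z.1 + g z'.1) ∂(γ : Measure (X × Y)) := by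
      intro z
      have h2 : ∀ y, ∫⁻ y', H (y, y') ∂τ
          = ∫⁻ z' in A, ∫⁻ y', H (y, y') ∂(η z'.1) ∂(γ : Measure (X × Y)) := fun y =>
        hτ' (fun y' => H (y, y')) (by fun_prop)
      simp_rw [h2]
      have h3 : Measurable (Function.uncurry fun (y : Y) (z' : X × Y) =>
          ∫⁻ y', H (y, y') ∂(η z'.1)) := by
        have : Measurable fun p : (Y × X) × Y => H (p.1.1, p.2) := by fun_prop
        have h4 := this.lintegral_kernel_prod_right' (κ := Kernel.prodMkLeft Y η)
        exact h4.comp (measurable_fst.prodMk (measurable_fst.comp measurable_snd))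
      rw [lintegral_lintegral_swap h3.aemeasurable]
      refine lintegral_mono fun z' => ?_
      rw [← lintegral_prod _ hH.aemeasurable]
      exact hη z.1 z'.1
    have h5 : ∀ z ∈ A, ∫⁻ z' in A, C * (1 + g z.1 + g z'.1) ∂(γ : Measure (X × Y))
        ≤ C * (1 + Φ z + ∫⁻ z', Φ z' ∂(γ : Measure (X × Y))) := by
      intro z hz
      rw [lintegral_const_mul _ (by fun_prop)]
      refine mul_le_mul_right ?_ _
      calc ∫⁻ z' in A, (1 + g z.1 + g z'.1) ∂(γ : Measure (X × Y))
          ≤ ∫⁻ z' in A, (1 + Φ z + Φ z') ∂(γ : Measure (X × Y)) :=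
            setLIntegral_mono' hA fun z' hz' => add_le_add (add_le_add le_rfl hz.1) hz'.1
        _ ≤ ∫⁻ z', (1 + Φ z + Φ z') ∂(γ : Measure (X × Y)) := setLIntegral_le_lintegral _ _
        _ = _ := by
          rw [lintegral_add_left measurable_const]
          simp
    calc _ ≤ ∫⁻ z in A, C * (1 + Φ z + ∫⁻ z', Φ z' ∂(γ : Measure (X × Y))) ∂(γ : Measure (X × Y)) :=
          setLIntegral_mono' hA fun z hz => (h1 z).trans (h5 z hz)
      _ ≤ ∫⁻ z, C * (1 + Φ z + ∫⁻ z', Φ z' ∂(γ : Measure (X × Y))) ∂(γ : Measure (X × Y)) :=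
          setLIntegral_le_lintegral _ _
      _ < ⊤ := by
          rw [lintegral_const_mul _ (by fun_prop), lintegral_add_right _ measurable_const,
            lintegral_add_right _ hΦ_meas]
          simp only [lintegral_const, measure_univ, mul_one]
          exact ENNReal.mul_lt_top (by simp) (by simp [lt_top_iff_ne_top, hΦ_fin])
  have hστ : ∫⁻ y, ∫⁻ y', H (y, y') ∂τ ∂σ < ⊤ := by
    refine lt_of_le_of_lt ?_ hτν
    calc ∫⁻ y, ∫⁻ y', H (y, y') ∂τ ∂σ ≤ ∫⁻ y, ∫⁻ y', H (y, y') ∂τ ∂(ν : Measure Y) :=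
          lintegral_mono' hσν le_rfl
      _ = ∫⁻ y', ∫⁻ y, H (y, y') ∂(ν : Measure Y) ∂τ :=
          lintegral_lintegral_swap hH.aemeasurable
      _ = _ := by simp_rw [fun y y' => hH_symm y y']
  have hτσ : ∫⁻ y, ∫⁻ y', H (y, y') ∂σ ∂τ < ⊤ :=
    lt_of_le_of_lt (lintegral_mono fun y => lintegral_mono' hσν le_rfl) hτν
  have hσσ : ∫⁻ y, ∫⁻ y', H (y, y') ∂σ ∂σ < ⊤ := by
    rw [limitPotential_of_mem hγ] at hfin
    refine lt_of_le_of_lt ?_ (ENNReal.add_lt_top.1 hfin).2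
    rw [interaction_eq_lintegral hH]
    exact lintegral_mono' hσν fun y => lintegral_mono' hσν le_rfl
  rw [interaction_eq_lintegral hH, hsnd]
  simp_rw [lintegral_add_measure]
  rw [lintegral_add_left hσm, lintegral_add_left hσm]
  exact (ENNReal.add_lt_top.2 ⟨ENNReal.add_lt_top.2 ⟨hσσ, hστ⟩,
    ENNReal.add_lt_top.2 ⟨hτσ, hττ⟩⟩).ne

end MeanField
theorem le_meanFieldCost {X Y : Type*} [MeasurableSpace Y] {c : X × Y → ℝ≥0∞} {L : Y → ℝ≥0∞}
    {H : Y × Y → ℝ≥0∞} (x : X) (y : Y) (ν : ProbabilityMeasure Y) :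
    L y ≤ meanFieldCost c L H x y ν :=
  le_add_right le_add_self

/-! ### Minimizers are equilibria under the regularization condition -/

section Equilibrium

variable {X Y : Type*} [TopologicalSpace X] [TopologicalSpace Y] [PolishSpace Y]
  [MeasurableSpace Y] [BorelSpace Y]
  {c : X × Y → ℝ≥0∞} {L : Y → ℝ≥0∞} {H : Y × Y → ℝ≥0∞}

theorem lowerSemicontinuous_lintegral_prodMk (hH : LowerSemicontinuous H)
    (ν : ProbabilityMeasure Y) :
    LowerSemicontinuous fun y => ∫⁻ y', H (y, y') ∂(ν : Measure Y) := by
  have h : LowerSemicontinuous fun y => interaction H (diracProba y) ν :=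
    (lowerSemicontinuous_interaction hH).comp (g := fun y => (diracProba y, ν))
      (continuous_diracProba.prodMk continuous_const)
  convert h using 2 with y
  rw [interaction_eq_lintegral hH.measurable]
  exact (lintegral_dirac' y hH.measurable.lintegral_prod_right').symm

theorem lowerSemicontinuous_meanFieldCost (hc : LowerSemicontinuous c)
    (hL : LowerSemicontinuous L) (hH : LowerSemicontinuous H) (ν : ProbabilityMeasure Y) :
    LowerSemicontinuous fun z : X × Y => meanFieldCost c L H z.1 z.2 ν :=
  (hc.add (hL.comp continuous_snd)).add (lowerSemicontinuous_const_mul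
    ((lowerSemicontinuous_lintegral_prodMk hH ν).comp continuous_snd) (by simp))

variable [MeasurableSpace X] [BorelSpace X]

theorem exists_measurable_near_best_response [Nonempty Y] (hc : LowerSemicontinuous c)
    (hL : LowerSemicontinuous L) (hH : LowerSemicontinuous H)
    (hL_compact : ∀ r : ℝ≥0, 0 < r → IsCompact {y : Y | L y ≤ r}) (ν : ProbabilityMeasure Y)
    {ε : ℝ≥0} (hε : 0 < ε) :
    ∃ T : X → Y, Measurable T ∧ ∀ x, (⨅ y, meanFieldCost c L H x y ν) < ⊤ →
      meanFieldCost c L H x (T x) ν ≤ (⨅ y, meanFieldCost c L H x y ν) + ε := by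
  refine exists_measurable_near_minimizer (lowerSemicontinuous_meanFieldCost hc hL hH ν)
    (fun r => ⟨_, hL_compact (r + 1) (by positivity), fun x y h => ?_⟩) hε
  refine (le_meanFieldCost x y ν).trans (h.trans ?_)
  exact_mod_cast le_self_add

theorem isCournotNash_of_minimizer (hc : LowerSemicontinuous c) (hL : LowerSemicontinuous L)
    (hH : LowerSemicontinuous H) (hH_symm : ∀ y y', H (y, y') = H (y', y))
    (hL_compact : ∀ r : ℝ≥0, 0 < r → IsCompact {y : Y | L y ≤ r})
    {μ : ProbabilityMeasure X} {γ : ProbabilityMeasure (X × Y)} (hγ : γ ∈ plansOver Y μ)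
    (hfin : limitPotential c L H μ γ < ⊤)
    (hmin : ∀ ρ ∈ plansOver Y μ, limitPotential c L H μ γ ≤ limitPotential c L H μ ρ)
    (hR : RegularizationCondition c L H) :
    IsCournotNash (meanFieldCost c L H) μ γ := by
  obtain ⟨C, κ, -, hκ, hκ_le, hκ_lim⟩ := hR
  have : Nonempty Y := (nonempty_of_isProbabilityMeasure (γ : Measure (X × Y))).map Prod.snd
  refine ⟨hγ, ?_⟩
  set ν := sndMarginal γ with hν
  have key : ∀ T : X → Y, Measurable T → ∀ᵐ z ∂(γ : Measure (X × Y)),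
      meanFieldCost c L H z.1 z.2 ν ≤ meanFieldCost c L H z.1 (T z.1) ν := by
    intro T hT
    have h1 : ∀ᵐ z ∂(γ : Measure (X × Y)), ∀ n,
        L (T z.1) ≤ meanFieldCost c L H z.1 z.2 ν → meanFieldCost c L H z.1 z.2 ν
          ≤ ∫⁻ w, meanFieldCost c L H z.1 w ν ∂(κ n (T z.1)) := ae_all_iff.2 fun n =>
      ae_le_lintegral_kernel_of_minimizer hc.measurable hL.measurable hH.measurable hH_symm hγ
        hfin hmin ((κ n).comap T hT) (g := fun x => L (T x)) (hL.measurable.comp hT) (C n)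
        fun x x' => hκ_le n (T x) (T x')
    filter_upwards [h1] with z hz
    -- Where `T` would be strictly better, its cost is finite, so (R) applies, and `L (T z.1)` lies
    -- below the current cost, so `hz` applies.
    by_contra hlt
    push Not at hlt
    exact absurd (ge_of_tendsto' (hκ_lim z.1 (T z.1) ν (hlt.trans_le le_top))
      fun n => hz n ((le_meanFieldCost z.1 (T z.1) ν).trans hlt.le)) (not_le.2 hlt)
  have hε : ∀ n : ℕ, (0 : ℝ≥0) < 1 / ((n : ℝ≥0) + 1) := fun n => by positivity
  choose T hT_meas hT using fun n : ℕ =>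
    exists_measurable_near_best_response hc hL hH hL_compact ν (hε n)
  filter_upwards [ae_all_iff.2 fun n => key (T n) (hT_meas n)] with z hz y'
  refine le_trans ?_ (iInf_le (fun y => meanFieldCost c L H z.1 y ν) y')
  rcases eq_top_or_lt_top (⨅ y, meanFieldCost c L H z.1 y ν) with htop | htop
  · rw [htop]
    exact le_top
  · have hlim : Tendsto (fun n : ℕ => (⨅ y, meanFieldCost c L H z.1 y ν)
        + ((1 / ((n : ℝ≥0) + 1) : ℝ≥0) : ℝ≥0∞)) atTop
        (𝓝 ((⨅ y, meanFieldCost c L H z.1 y ν) + ((0 : ℝ≥0) : ℝ≥0∞))) :=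
      tendsto_const_nhds.add (ENNReal.tendsto_coe.2 tendsto_one_div_add_atTop_nhds_zero_nat)
    rw [ENNReal.coe_zero, add_zero] at hlim
    exact ge_of_tendsto' hlim fun n => (hz n).trans (hT n z.1 htop)

end Equilibrium
-- Lindelöf's theorem for the open sets `{f i < q}`, with `q` in a countable dense set of
-- thresholds. It reduces uncountably many almost sure statements to countably many.
theorem exists_countable_subfamily {E ι : Type*} [TopologicalSpace E] [SecondCountableTopology E]
    {f : ι → E → ℝ≥0∞} (hf : ∀ i, Continuous (f i)) :
    ∃ S : Set ι, S.Countable ∧ ∀ e i b, f i e < b → ∃ j ∈ S, f j e < b := by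
  obtain ⟨D, hD, hD'⟩ := TopologicalSpace.exists_countable_dense ℝ≥0∞
  choose S hS hS' using fun q : ℝ≥0∞ =>
    TopologicalSpace.isOpen_iUnion_countable (fun i => {e | f i e < q})
      fun i => isOpen_lt (hf i) continuous_const
  refine ⟨⋃ q ∈ D, S q, hD.biUnion fun q _ => hS q, fun e i b hb => ?_⟩
  obtain ⟨q, hqD, hq, hqb⟩ := hD'.exists_between hb
  have he : e ∈ ⋃ j ∈ S q, {e | f j e < q} := by
    rw [hS' q]
    exact Set.mem_iUnion.2 ⟨i, hq⟩
  simp only [Set.mem_iUnion, exists_prop] at he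
  obtain ⟨j, hj, hje⟩ := he
  exact ⟨j, Set.mem_biUnion hqD hj, lt_trans hje hqb⟩

/-! ### Averaged equilibrium inequalities for bounded interaction -/

section Bounded

variable {X Y : Type*} [MeasurableSpace X] [MeasurableSpace Y]
  {c : X × Y → ℝ≥0∞} {L : Y → ℝ≥0∞} {H : Y × Y → ℝ≥0∞}

theorem interaction_le_of_le {M : ℝ≥0} (hM : ∀ z, H z ≤ M) (ν ν' : ProbabilityMeasure Y) :
    interaction H ν ν' ≤ M :=
  (lintegral_mono hM).trans (by simp)

theorem interaction_diracProba (hH : Measurable H) (y : Y) (ν : ProbabilityMeasure Y) :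
    interaction H (diracProba y) ν = ∫⁻ y', H (y, y') ∂(ν : Measure Y) := by
  rw [interaction_eq_lintegral hH]
  exact lintegral_dirac' y hH.lintegral_prod_right'

/-- Each player is tested against the pure strategy `T (x i)`. Adding the missing self-interaction
on the left costs at most `2 * M / N`; on the right it is added for free. -/
theorem IsNashEquilibrium.average_le {N : ℕ} (hc : Measurable c) (hL : Measurable L)
    (hH : Measurable H) {M : ℝ≥0} (hM : ∀ z, H z ≤ M) {x : Fin N → X}
    {ν : Fin N → ProbabilityMeasure Y} {γ : ProbabilityMeasure (X × Y)}
    (hγ : (γ : Measure (X × Y)) = profilePlan x ν)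
    (hν : IsNashEquilibrium (closedLoopCost c L H x) ν) (T : X → Y) :
    ∫⁻ z, c z ∂(γ : Measure (X × Y)) + meanCost L (sndMarginal γ)
        + 2 * interaction H (sndMarginal γ) (sndMarginal γ)
      ≤ (N : ℝ≥0∞)⁻¹ * ∑ i, (c (x i, T (x i)) + L (T (x i)))
        + 2 * ((N : ℝ≥0∞)⁻¹ *
          ∑ i, ∫⁻ y', H (T (x i), y') ∂(sndMarginal γ : Measure Y))
        + (N : ℝ≥0∞)⁻¹ * (2 * M) := by
  have hi : ∀ i, ∫⁻ y, c (x i, y) ∂(ν i : Measure Y) + meanCost L (ν i)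
      + 2 * ((N : ℝ≥0∞)⁻¹ * ∑ j, interaction H (ν i) (ν j))
      ≤ c (x i, T (x i)) + L (T (x i))
        + 2 * ∫⁻ y', H (T (x i), y') ∂(sndMarginal γ : Measure Y) + (N : ℝ≥0∞)⁻¹ * (2 * M) := by
    intro i
    have hdev : closedLoopCost c L H x i (Function.update ν i (diracProba (T (x i))))
        ≤ c (x i, T (x i)) + L (T (x i))
          + 2 * ∫⁻ y', H (T (x i), y') ∂(sndMarginal γ : Measure Y) := by
      have e1 : ∫⁻ y, c (x i, y) ∂((diracProba (T (x i)) : ProbabilityMeasure Y) : Measure Y)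
          = c (x i, T (x i)) := lintegral_dirac' _ (by fun_prop)
      have e2 : meanCost L (diracProba (T (x i))) = L (T (x i)) := lintegral_dirac' _ hL
      rw [closedLoopCost, Function.update_self, e1, e2,
        ← interaction_diracProba hH, interaction_sndMarginal_right hH hγ, div_eq_mul_inv, mul_assoc]
      refine add_le_add le_rfl (mul_le_mul_right (mul_le_mul_right ?_ _) _)
      calc ∑ j with j ≠ i, interaction H (diracProba (T (x i)))
            (Function.update ν i (diracProba (T (x i))) j)
          = ∑ j with j ≠ i, interaction H (diracProba (T (x i))) (ν j) :=
            Finset.sum_congr rfl fun j hj => by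
              rw [Function.update_of_ne (Finset.mem_filter.1 hj).2]
        _ ≤ _ := Finset.sum_le_sum_of_subset (Finset.filter_subset _ _)
    refine le_trans ?_ (add_le_add ((hν i _).trans hdev) le_rfl)
    rw [closedLoopCost, sum_eq_sum_ne_add _ i, div_eq_mul_inv, mul_add, mul_add, ← mul_assoc,
      ← add_assoc, mul_left_comm]
    exact add_le_add le_rfl (mul_le_mul_right (mul_le_mul_right (interaction_le_of_le hM _ _) _) _)
  have hsum := mul_le_mul_right (Finset.sum_le_sum fun i (_ : i ∈ Finset.univ) => hi i)
    (N : ℝ≥0∞)⁻¹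
  have hconst : (N : ℝ≥0∞)⁻¹ * ∑ _i : Fin N, (N : ℝ≥0∞)⁻¹ * (2 * M) ≤ (N : ℝ≥0∞)⁻¹ * (2 * M) := by
    rw [Finset.sum_const, Finset.card_univ, Fintype.card_fin, nsmul_eq_mul, ← mul_assoc]
    exact (mul_le_mul_left (ENNReal.inv_mul_le_one _) _).trans (by rw [one_mul])
  rw [meanCost, lintegral_sndMarginal γ hL, interaction_sndMarginal hH hγ, hγ,
    lintegral_profilePlan _ _ hc, lintegral_profilePlan_snd _ _ hL, sq,
    ENNReal.mul_inv (Or.inr (ENNReal.natCast_ne_top _)) (Or.inl (ENNReal.natCast_ne_top _))]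
  simp only [Finset.sum_add_distrib, ← Finset.mul_sum, mul_add] at hsum hconst ⊢
  refine le_trans (le_of_eq ?_) (hsum.trans (le_trans (add_le_add le_rfl hconst) (le_of_eq ?_)))
  · simp only [meanCost]
    ring
  · ring

end Bounded

/-! ### Limits of equilibria for bounded continuous interaction -/

section Limit

variable {X Y : Type*} [TopologicalSpace X] [MeasurableSpace X] [BorelSpace X]
  [TopologicalSpace Y] [PolishSpace Y] [MeasurableSpace Y] [BorelSpace Y]
  {c : X × Y → ℝ≥0∞} {L : Y → ℝ≥0∞} {H : Y × Y → ℝ≥0∞}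

theorem continuous_interaction (hH : Continuous H) {M : ℝ≥0} (hM : ∀ z, H z ≤ M) :
    Continuous fun p : ProbabilityMeasure Y × ProbabilityMeasure Y => interaction H p.1 p.2 := by
  have hne : ∀ z, H z ≠ ⊤ := fun z => ne_top_of_le_ne_top ENNReal.coe_ne_top (hM z)
  let h : BoundedContinuousFunction (Y × Y) ℝ≥0 :=
    BoundedContinuousFunction.mkOfBound
      ⟨fun z => (H z).toNNReal, ENNReal.continuousOn_toNNReal.comp_continuous hH hne⟩ M
      fun z z' => by
        rw [NNReal.dist_eq, abs_sub_le_iff]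
        have h1 : ∀ z, ((H z).toNNReal : ℝ) ≤ M := fun z => by
          exact_mod_cast ENNReal.toNNReal_mono ENNReal.coe_ne_top (hM z)
        have h2 : ∀ z, 0 ≤ ((H z).toNNReal : ℝ) := fun z => NNReal.coe_nonneg _
        have := h1 z
        have := h1 z'
        have := h2 z
        have := h2 z'
        constructor <;> simp only [ContinuousMap.coe_mk] <;> linarith
  have h1 : ∀ p : ProbabilityMeasure Y × ProbabilityMeasure Y, interaction H p.1 p.2
      = ∫⁻ z, h z ∂(p.1.prod p.2 : Measure (Y × Y)) := fun p =>
    lintegral_congr fun z => (ENNReal.coe_toNNReal (hne z)).symm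
  simp_rw [h1]
  exact (ProbabilityMeasure.continuous_lintegral_boundedContinuousFunction h).comp
    ProbabilityMeasure.continuous_prod

theorem isCournotNash_of_forall_lintegral_le (hc : LowerSemicontinuous c)
    (hL : LowerSemicontinuous L) (hH : LowerSemicontinuous H) {M : ℝ≥0} (hM : ∀ z, H z ≤ M)
    (hL_compact : ∀ r : ℝ≥0, 0 < r → IsCompact {y : Y | L y ≤ r})
    {μ : ProbabilityMeasure X} {γ₀ γ : ProbabilityMeasure (X × Y)} (hγ₀ : γ₀ ∈ plansOver Y μ)
    (hfin : limitPotential c L H μ γ₀ < ⊤) (hγ : γ ∈ plansOver Y μ)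
    (hle : ∀ T : X → Y, Measurable T → ∫⁻ x, (c (x, T x) + L (T x)) ∂(μ : Measure X) ≠ ⊤ →
      ∫⁻ z, meanFieldCost c L H z.1 z.2 (sndMarginal γ) ∂(γ : Measure (X × Y))
        ≤ ∫⁻ x, meanFieldCost c L H x (T x) (sndMarginal γ) ∂(μ : Measure X)) :
    IsCournotNash (meanFieldCost c L H) μ γ := by
  have : Nonempty Y := (nonempty_of_isProbabilityMeasure (γ : Measure (X × Y))).map Prod.snd
  refine ⟨hγ, ?_⟩
  set ν := sndMarginal γ with hν
  have hΦ := measurable_meanFieldCost hc.measurable hL.measurable hH.measurable ν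
  have hΦT : ∀ T : X → Y, Measurable T → Measurable fun x => meanFieldCost c L H x (T x) ν :=
    fun T hT => hΦ.comp (measurable_id.prodMk hT)
  have hmarg : ∀ ρ ∈ plansOver Y μ, ∀ T : X → Y, Measurable T →
      ∫⁻ x, meanFieldCost c L H x (T x) ν ∂(μ : Measure X)
        = ∫⁻ z, meanFieldCost c L H z.1 (T z.1) ν ∂(ρ : Measure (X × Y)) := by
    intro ρ hρ T hT
    rw [← show (ρ : Measure (X × Y)).map Prod.fst = (μ : Measure X) from hρ,
      lintegral_map (hΦT T hT) measurable_fst]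
  have hΦ₀ : ∫⁻ z, meanFieldCost c L H z.1 z.2 ν ∂(γ₀ : Measure (X × Y)) ≠ ⊤ := by
    rw [limitPotential_of_mem hγ₀] at hfin
    rw [lintegral_meanFieldCost hc.measurable hL.measurable hH.measurable]
    refine ENNReal.add_ne_top.2 ⟨(ENNReal.add_lt_top.1 hfin).1.ne,
      ENNReal.mul_ne_top (by simp) ?_⟩
    exact ne_top_of_le_ne_top ENNReal.coe_ne_top (interaction_le_of_le hM _ _)
  -- `γ₀` provides a response of finite cost against `ν`, because `H` is bounded; a near best
  -- response then also has finite cost and may be used in `hle`.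
  have hnear : ∀ (ε : ℝ≥0) (T : X → Y), Measurable T →
      (∀ x, (⨅ y, meanFieldCost c L H x y ν) < ⊤ →
        meanFieldCost c L H x (T x) ν ≤ (⨅ y, meanFieldCost c L H x y ν) + ε) →
      ∫⁻ x, meanFieldCost c L H x (T x) ν ∂(μ : Measure X) ≠ ⊤ := by
    intro ε T hT hTε
    rw [hmarg γ₀ hγ₀ T hT]
    have h1 : ∫⁻ z, (meanFieldCost c L H z.1 z.2 ν + ε) ∂(γ₀ : Measure (X × Y)) ≠ ⊤ := by
      rw [lintegral_add_right _ measurable_const]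
      simp [hΦ₀]
    refine ne_top_of_le_ne_top h1 (lintegral_mono_ae ?_)
    filter_upwards [ae_lt_top hΦ hΦ₀] with z hz
    have h2 : (⨅ y, meanFieldCost c L H z.1 y ν) ≤ meanFieldCost c L H z.1 z.2 ν := iInf_le _ z.2
    exact (hTε z.1 (h2.trans_lt hz)).trans (add_le_add h2 le_rfl)
  have hG : ∀ T : X → Y, ∫⁻ x, meanFieldCost c L H x (T x) ν ∂(μ : Measure X) ≠ ⊤ →
      ∫⁻ x, (c (x, T x) + L (T x)) ∂(μ : Measure X) ≠ ⊤ := fun T h =>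
    ne_top_of_le_ne_top h (lintegral_mono fun x => le_self_add)
  have hbound : ∀ ε : ℝ≥0, 0 < ε →
      ∫⁻ z, meanFieldCost c L H z.1 z.2 ν ∂(γ : Measure (X × Y)) ≠ ⊤ ∧
      ∫⁻ z, meanFieldCost c L H z.1 z.2 ν ∂(γ : Measure (X × Y))
        ≤ ∫⁻ z, (⨅ y, meanFieldCost c L H z.1 y ν) ∂(γ : Measure (X × Y)) + ε := by
    intro ε hε
    obtain ⟨T, hT, hTε⟩ := exists_measurable_near_best_response hc hL hH hL_compact ν hε
    have h1 := hnear ε T hT hTε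
    have h2 := hle T hT (hG T h1)
    refine ⟨ne_top_of_le_ne_top h1 h2, h2.trans ?_⟩
    rw [hmarg γ hγ T hT] at h1 ⊢
    calc ∫⁻ z, meanFieldCost c L H z.1 (T z.1) ν ∂(γ : Measure (X × Y))
        ≤ ∫⁻ z, ((⨅ y, meanFieldCost c L H z.1 y ν) + ε) ∂(γ : Measure (X × Y)) := by
          refine lintegral_mono_ae ?_
          filter_upwards [ae_lt_top ((hΦT T hT).comp measurable_fst) h1] with z hz
          exact hTε z.1 ((iInf_le _ (T z.1)).trans_lt hz)
      _ = _ := by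
          rw [lintegral_add_right _ measurable_const]
          simp
  have hle' : ∫⁻ z, meanFieldCost c L H z.1 z.2 ν ∂(γ : Measure (X × Y))
      ≤ ∫⁻ z, (⨅ y, meanFieldCost c L H z.1 y ν) ∂(γ : Measure (X × Y)) :=
    ENNReal.le_of_forall_pos_le_add fun ε hε _ => (hbound ε hε).2
  have hV : ∀ z : X × Y, (⨅ y, meanFieldCost c L H z.1 y ν) ≤ meanFieldCost c L H z.1 z.2 ν :=
    fun z => iInf_le _ z.2
  have hVfin : ∫⁻ z, (⨅ y, meanFieldCost c L H z.1 y ν) ∂(γ : Measure (X × Y)) ≠ ⊤ :=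
    ne_top_of_le_ne_top (hbound 1 one_pos).1 (lintegral_mono hV)
  -- Only `Φ`, the larger function, needs to be measurable; the pointwise infimum over `y` does not.
  filter_upwards [ae_eq_of_ae_le_of_lintegral_le (Eventually.of_forall hV) hVfin hΦ.aemeasurable
    hle'] with z hz y'
  rw [← hz]
  exact iInf_le _ y'

variable [PolishSpace X]

/-- The left side of the averaged inequality is lower semicontinuous in the plan. `T` need not be
continuous, since the convergence of its empirical images is supplied by `hT_emp`. -/
theorem lintegral_meanFieldCost_le_of_tendsto (hc : LowerSemicontinuous c)
    (hL : LowerSemicontinuous L) (hH : Continuous H) {M : ℝ≥0} (hM : ∀ z, H z ≤ M)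
    {μ : ProbabilityMeasure X} {x : ℕ → X} {γ : ℕ → ProbabilityMeasure (X × Y)}
    {γ' : ProbabilityMeasure (X × Y)}
    (hγ : ∀ n, IsClosedLoopNash c L H (fun i : Fin (n + 1) => x i) (γ n))
    (hlim : Tendsto γ atTop (𝓝 γ')) {T : X → Y} (hT : Measurable T)
    (hT_emp : Tendsto (empirical fun i => T (x i)) atTop (𝓝 (μ.map hT.aemeasurable)))
    (hT_int : Tendsto (fun n => ∫⁻ x, (c (x, T x) + L (T x)) ∂(empirical x n : Measure X)) atTop
      (𝓝 (∫⁻ x, (c (x, T x) + L (T x)) ∂(μ : Measure X)))) :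
    ∫⁻ z, meanFieldCost c L H z.1 z.2 (sndMarginal γ') ∂(γ' : Measure (X × Y))
      ≤ ∫⁻ x, (c (x, T x) + L (T x)) ∂(μ : Measure X)
        + 2 * interaction H (μ.map hT.aemeasurable) (sndMarginal γ') := by
  have hcm := hc.measurable
  have hLm := hL.measurable
  have hHm := hH.measurable
  rw [lintegral_meanFieldCost hcm hLm hHm]
  have hG : LowerSemicontinuous fun ρ : ProbabilityMeasure (X × Y) =>
      ∫⁻ z, c z ∂(ρ : Measure (X × Y)) + meanCost L (sndMarginal ρ)
        + 2 * interaction H (sndMarginal ρ) (sndMarginal ρ) :=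
    ((lowerSemicontinuous_lintegral hc).add
      ((lowerSemicontinuous_lintegral hL).comp continuous_sndMarginal)).add
      (lowerSemicontinuous_const_mul ((lowerSemicontinuous_interaction hH.lowerSemicontinuous).comp
        (g := fun ρ : ProbabilityMeasure (X × Y) => (sndMarginal ρ, sndMarginal ρ))
        (continuous_sndMarginal.prodMk continuous_sndMarginal)) (by simp))
  have hI : Tendsto (fun n => interaction H (empirical (fun i => T (x i)) n) (sndMarginal (γ n)))
      atTop (𝓝 (interaction H (μ.map hT.aemeasurable) (sndMarginal γ'))) :=
    ((continuous_interaction hH hM).tendsto (μ.map hT.aemeasurable, sndMarginal γ')).comp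
      (hT_emp.prodMk_nhds ((continuous_sndMarginal.tendsto γ').comp hlim))
  have ha : Tendsto (fun n : ℕ => ∫⁻ x, (c (x, T x) + L (T x)) ∂(empirical x n : Measure X)
      + 2 * interaction H (empirical (fun i => T (x i)) n) (sndMarginal (γ n))
      + ((n + 1 : ℕ) : ℝ≥0∞)⁻¹ * (2 * M)) atTop
      (𝓝 (∫⁻ x, (c (x, T x) + L (T x)) ∂(μ : Measure X)
        + 2 * interaction H (μ.map hT.aemeasurable) (sndMarginal γ') + 0 * (2 * M))) := by
    refine (hT_int.add (ENNReal.Tendsto.const_mul hI (Or.inr (by simp)))).add ?_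
    refine ENNReal.Tendsto.mul_const ?_ (Or.inr (ENNReal.mul_ne_top (by simp) (by simp)))
    exact ENNReal.tendsto_inv_nat_nhds_zero.comp (tendsto_add_atTop_nat 1)
  rw [zero_mul, add_zero] at ha
  refine le_of_tendsto_of_lowerSemicontinuous hG hlim ha fun n => ?_
  obtain ⟨ν, hν, hnash⟩ := hγ n
  refine (hnash.average_le hcm hLm hHm hM hν T).trans (le_of_eq ?_)
  have hm : Measurable fun y => ∫⁻ y', H (y, y') ∂(sndMarginal (γ n) : Measure Y) :=
    hHm.lintegral_prod_right'
  rw [lintegral_empirical x n (f := fun x => c (x, T x) + L (T x)) (by fun_prop),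
    interaction_eq_lintegral hHm, lintegral_empirical _ n hm, Finset.sum_range, Finset.sum_range]

variable {Ω : Type*} [MeasurableSpace Ω] {P : Measure Ω}

theorem ae_isCournotNash_of_tendsto_isClosedLoopNash {μ : ProbabilityMeasure X} {ξ : ℕ → Ω → X}
    (hξ_meas : ∀ i, Measurable (ξ i)) (hξ_indep : iIndepFun ξ P)
    (hξ_law : ∀ i, P.map (ξ i) = (μ : Measure X))
    (hc : LowerSemicontinuous c) (hL : LowerSemicontinuous L) (hH : Continuous H)
    {M : ℝ≥0} (hM : ∀ z, H z ≤ M)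
    (hL_compact : ∀ r : ℝ≥0, 0 < r → IsCompact {y : Y | L y ≤ r})
    {γ₀ : ProbabilityMeasure (X × Y)} (hγ₀ : γ₀ ∈ plansOver Y μ)
    (hfin : limitPotential c L H μ γ₀ < ⊤) :
    ∀ᵐ ω ∂P, ∀ (γ : ℕ → ProbabilityMeasure (X × Y)) (γ' : ProbabilityMeasure (X × Y)),
      (∀ N : ℕ, 1 ≤ N → IsClosedLoopNash c L H (fun i : Fin N => ξ i ω) (γ N)) →
      Tendsto γ atTop (𝓝 γ') →
      γ' ∈ plansOver Y μ ∧ IsCournotNash (meanFieldCost c L H) μ γ' := by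
  have hcm := hc.measurable
  have hLm := hL.measurable
  have hHm := hH.measurable
  let ι := {T : X → Y // Measurable T ∧ ∫⁻ x, (c (x, T x) + L (T x)) ∂(μ : Measure X) ≠ ⊤}
  -- The limiting cost of the deviation `T` as a function of the second marginal; its continuity is
  -- what permits countably many `T`.
  let f : ι → ProbabilityMeasure Y → ℝ≥0∞ := fun T ν =>
    ∫⁻ x, (c (x, T.1 x) + L (T.1 x)) ∂(μ : Measure X)
      + 2 * interaction H (μ.map T.2.1.aemeasurable) ν
  have hf : ∀ T, Continuous (f T) := fun T =>
    continuous_const.add ((ENNReal.continuous_const_mul (by simp)).comp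
      ((continuous_interaction hH hM).comp (Continuous.prodMk_right _)))
  obtain ⟨S, hS, hS'⟩ := exists_countable_subfamily hf
  have : Countable S := hS.to_subtype
  have h1 : ∀ᵐ ω ∂P, ∀ T : S, Tendsto (empirical fun i => T.1.1 (ξ i ω)) atTop
      (𝓝 (μ.map T.1.2.1.aemeasurable)) := ae_all_iff.2 fun T =>
    -- The variables `T (ξ i)` are again independent, with law the image of `μ`, so no regularity of
    -- `T` beyond measurability is used.
    ae_tendsto_empirical (ξ := fun i ω => T.1.1 (ξ i ω)) (fun i => T.1.2.1.comp (hξ_meas i))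
      (hξ_indep.comp (fun _ => T.1.1) fun _ => T.1.2.1) fun i => by
        change P.map (T.1.1 ∘ ξ i) = (μ : Measure X).map T.1.1
        rw [← Measure.map_map T.1.2.1 (hξ_meas i), hξ_law]
  have h2 : ∀ᵐ ω ∂P, ∀ T : S, Tendsto
      (fun n => ∫⁻ x, (c (x, T.1.1 x) + L (T.1.1 x)) ∂(empirical (fun i => ξ i ω) n : Measure X))
      atTop (𝓝 (∫⁻ x, (c (x, T.1.1 x) + L (T.1.1 x)) ∂(μ : Measure X))) := ae_all_iff.2 fun T => by
    have hT := T.1.2.1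
    exact ae_tendsto_lintegral_empirical hξ_meas hξ_indep hξ_law (by fun_prop) T.1.2.2
  filter_upwards [h1, h2, ae_tendsto_empirical hξ_meas hξ_indep hξ_law] with ω h1 h2 h3 γ γ' hγ hlim
  have hlim' := hlim.comp (tendsto_add_atTop_nat 1)
  have hγ' : γ' ∈ plansOver Y μ := by
    have h4 := ProbabilityMeasure.tendsto_map_of_tendsto_of_continuous _ _ hlim' continuous_fst
    refine congrArg (fun ρ : ProbabilityMeasure X => (ρ : Measure X))
      (tendsto_nhds_unique h4 (h3.congr fun n => ?_))
    obtain ⟨ν, hν, -⟩ := hγ (n + 1) (by omega)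
    exact (map_fst_eq_empirical (x := fun i => ξ i ω) hν).symm
  refine ⟨hγ', isCournotNash_of_forall_lintegral_le hc hL hH.lowerSemicontinuous hM hL_compact
    hγ₀ hfin hγ' fun T hT hTfin => ?_⟩
  have h5 : ∫⁻ x, meanFieldCost c L H x (T x) (sndMarginal γ') ∂(μ : Measure X)
      = f ⟨T, hT, hTfin⟩ (sndMarginal γ') := by
    have hm : Measurable fun y => ∫⁻ y', H (y, y') ∂(sndMarginal γ' : Measure Y) :=
      hHm.lintegral_prod_right'
    have hm' : Measurable fun x => ∫⁻ y', H (T x, y') ∂(sndMarginal γ' : Measure Y) := hm.comp hT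
    simp only [f, meanFieldCost]
    rw [lintegral_add_left (by fun_prop), lintegral_const_mul _ hm', interaction_eq_lintegral hHm]
    congr 2
    exact (lintegral_map hm hT).symm
  rw [h5]
  by_contra hlt
  obtain ⟨T', hT', hlt'⟩ := hS' _ _ _ (not_le.1 hlt)
  refine absurd (lintegral_meanFieldCost_le_of_tendsto (μ := μ) (x := fun i => ξ i ω) hc hL hH hM
    (fun n => hγ (n + 1) (by omega)) hlim' T'.2.1 (h1 ⟨T', hT'⟩) (h2 ⟨T', hT'⟩)) (not_le.2 hlt')

end Limit

/-! ### Random profiles sampled from a plan -/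

section Sampling

variable {X Y Ω : Type*} [MeasurableSpace X] [MeasurableSpace Y] [MeasurableSpace Ω]
  {P : Measure Ω} {μ : ProbabilityMeasure X} {ξ : ℕ → Ω → X}

theorem map_prodMk_eq_prod [IsProbabilityMeasure P]
    (hξ_meas : ∀ i, Measurable (ξ i)) (hξ_indep : iIndepFun ξ P)
    (hξ_law : ∀ i, P.map (ξ i) = (μ : Measure X)) {i j : ℕ} (hij : i ≠ j) :
    P.map (fun ω => (ξ i ω, ξ j ω)) = (μ : Measure X).prod (μ : Measure X) := by
  rw [(indepFun_iff_map_prod_eq_prod_map_map (hξ_meas i).aemeasurable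
    (hξ_meas j).aemeasurable).1 (hξ_indep.indepFun hij), hξ_law, hξ_law]

theorem ae_injective_of_noAtoms [IsProbabilityMeasure P] [MeasurableEq X]
    (hμ : ∀ x : X, (μ : Measure X) {x} = 0)
    (hξ_meas : ∀ i, Measurable (ξ i)) (hξ_indep : iIndepFun ξ P)
    (hξ_law : ∀ i, P.map (ξ i) = (μ : Measure X)) :
    ∀ᵐ ω ∂P, Function.Injective fun i => ξ i ω := by
  have h : ∀ᵐ ω ∂P, ∀ i j, i ≠ j → ξ i ω ≠ ξ j ω := by
    refine ae_all_iff.2 fun i => ae_all_iff.2 fun j => ?_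
    by_cases hij : i = j
    · exact Eventually.of_forall fun ω h => absurd hij h
    have hd : MeasurableSet (Set.diagonal X) := measurableSet_diagonal
    have h0 : ((μ : Measure X).prod (μ : Measure X)) (Set.diagonal X) = 0 := by
      rw [Measure.measure_prod_null hd]
      refine Eventually.of_forall fun x => ?_
      have : Prod.mk x ⁻¹' Set.diagonal X = {x} := by
        ext y
        simp [eq_comm]
      change (μ : Measure X) (Prod.mk x ⁻¹' Set.diagonal X) = 0
      rw [this]
      exact hμ x
    rw [← map_prodMk_eq_prod hξ_meas hξ_indep hξ_law hij,
      Measure.map_apply ((hξ_meas i).prodMk (hξ_meas j)) hd] at h0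
    have : ∀ᵐ ω ∂P, ξ i ω ≠ ξ j ω := by
      rw [ae_iff]
      convert h0 using 2
      ext ω
      simp
    exact this.mono fun ω h _ => h
  filter_upwards [h] with ω hω i j hij
  by_contra hne
  exact hω i j hne hij

/-- The profile in which a player of type `x` plays the mixed strategy `κ x`. -/
noncomputable def kernelProfile (κ : Kernel X Y) [IsMarkovKernel κ] {N : ℕ} (x : Fin N → X) :
    Fin N → ProbabilityMeasure Y :=
  fun i => ⟨κ (x i), inferInstance⟩

variable {c : X × Y → ℝ≥0∞} {L : Y → ℝ≥0∞} {H : Y × Y → ℝ≥0∞} (κ : Kernel X Y) [IsMarkovKernel κ]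

theorem profileEnergy_kernelProfile {N : ℕ} (x : Fin N → X) :
    profileEnergy c L H x (kernelProfile κ x)
      = (N : ℝ≥0∞)⁻¹ * ∑ i, ∫⁻ y, c (x i, y) ∂(κ (x i)) + (N : ℝ≥0∞)⁻¹ * ∑ i, ∫⁻ y, L y ∂(κ (x i))
        + ((N : ℝ≥0∞) ^ 2)⁻¹ * ∑ i, ∑ j with j ≠ i, ∫⁻ z, H z ∂((κ (x i)).prod (κ (x j))) := rfl

theorem measurable_lintegral_kernel_prod (hH : Measurable H) :
    Measurable fun p : X × X => ∫⁻ z, H z ∂((κ p.1).prod (κ p.2)) := by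
  have h1 : ∀ p : X × X, ∫⁻ z, H z ∂((κ p.1).prod (κ p.2))
      = ∫⁻ y, ∫⁻ y', H (y, y') ∂(κ p.2) ∂(κ p.1) := fun p => lintegral_prod _ hH.aemeasurable
  simp_rw [h1]
  have h2 : Measurable fun q : (X × X) × Y => ∫⁻ y', H (q.2, y') ∂(κ q.1.2) := by
    have h3 : Measurable fun q : ((X × X) × Y) × Y => H (q.1.2, q.2) := by fun_prop
    exact h3.lintegral_kernel_prod_right'
      (κ := κ.comap (fun q : (X × X) × Y => q.1.2) (by fun_prop))
  exact h2.lintegral_kernel_prod_right' (κ := κ.comap Prod.fst measurable_fst)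

theorem measurable_profileEnergy_kernelProfile (hc : Measurable c) (hL : Measurable L)
    (hH : Measurable H) {N : ℕ} :
    Measurable fun x : Fin N → X => profileEnergy c L H x (kernelProfile κ x) := by
  simp_rw [profileEnergy_kernelProfile]
  have h1 : Measurable fun x => ∫⁻ y, c (x, y) ∂(κ x) := hc.lintegral_kernel_prod_right'
  have h2 : Measurable fun x => ∫⁻ y, L y ∂(κ x) := hL.lintegral_kernel
  have h3 := measurable_lintegral_kernel_prod κ hH
  refine Measurable.add (Measurable.add ?_ ?_) ?_
  · exact (Finset.measurable_fun_sum _ fun i _ => h1.comp (measurable_pi_apply i)).const_mul _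
  · exact (Finset.measurable_fun_sum _ fun i _ => h2.comp (measurable_pi_apply i)).const_mul _
  · exact (Finset.measurable_fun_sum _ fun i _ => Finset.measurable_fun_sum _ fun j _ =>
      h3.comp ((measurable_pi_apply i).prodMk (measurable_pi_apply j))).const_mul _

/-- For `i ≠ j` independence turns the expected interaction into that of the second marginal with
itself. Self-interactions of `κ x`, which might be infinite, do not enter. -/
theorem lintegral_profileEnergy_kernelProfile_le [IsProbabilityMeasure P]
    (hξ_meas : ∀ i, Measurable (ξ i)) (hξ_indep : iIndepFun ξ P)
    (hξ_law : ∀ i, P.map (ξ i) = (μ : Measure X)) (hc : Measurable c) (hL : Measurable L)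
    (hH : Measurable H) {γ : ProbabilityMeasure (X × Y)} (hγ : γ ∈ plansOver Y μ)
    (hκ : (μ : Measure X) ⊗ₘ κ = (γ : Measure (X × Y))) (N : ℕ) :
    ∫⁻ ω, profileEnergy c L H (fun i : Fin N => ξ i ω) (kernelProfile κ fun i : Fin N => ξ i ω) ∂P
      ≤ limitPotential c L H μ γ := by
  have h1 : Measurable fun x => ∫⁻ y, c (x, y) ∂(κ x) := hc.lintegral_kernel_prod_right'
  have h2 : Measurable fun x => ∫⁻ y, L y ∂(κ x) := hL.lintegral_kernel
  have h3 := measurable_lintegral_kernel_prod κ hH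
  have hsnd : ∀ f : Y → ℝ≥0∞, Measurable f → ∫⁻ y, f y ∂(sndMarginal γ : Measure Y)
      = ∫⁻ x, ∫⁻ y, f y ∂(κ x) ∂(μ : Measure X) := fun f hf => by
    rw [lintegral_sndMarginal _ hf, ← hκ,
      Measure.lintegral_compProd (f := fun z : X × Y => f z.2) (by fun_prop)]
  have e1 : ∀ i, ∫⁻ ω, ∫⁻ y, c (ξ i ω, y) ∂(κ (ξ i ω)) ∂P = ∫⁻ z, c z ∂(γ : Measure (X × Y)) :=
    fun i => by
      rw [← hκ, Measure.lintegral_compProd hc, ← hξ_law i, lintegral_map h1 (hξ_meas i)]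
  have e2 : ∀ i, ∫⁻ ω, ∫⁻ y, L y ∂(κ (ξ i ω)) ∂P = meanCost L (sndMarginal γ) := fun i => by
    rw [meanCost, hsnd L hL, ← hξ_law i, lintegral_map h2 (hξ_meas i)]
  have e3 : ∀ i j, i ≠ j → ∫⁻ ω, ∫⁻ z, H z ∂((κ (ξ i ω)).prod (κ (ξ j ω))) ∂P
      = interaction H (sndMarginal γ) (sndMarginal γ) := fun i j hij => by
    rw [← lintegral_map (f := fun p : X × X => ∫⁻ z, H z ∂((κ p.1).prod (κ p.2))) h3
      ((hξ_meas i).prodMk (hξ_meas j)), map_prodMk_eq_prod hξ_meas hξ_indep hξ_law hij,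
      lintegral_prod _ h3.aemeasurable, interaction_eq_lintegral hH,
      hsnd _ hH.lintegral_prod_right']
    refine lintegral_congr fun x => ?_
    simp_rw [fun y => hsnd (fun y' => H (y, y')) (by fun_prop)]
    have h4 : Measurable (Function.uncurry fun (y : Y) (x' : X) => ∫⁻ y', H (y, y') ∂(κ x')) := by
      have h5 : Measurable fun p : (Y × X) × Y => H (p.1.1, p.2) := by fun_prop
      exact h5.lintegral_kernel_prod_right' (κ := Kernel.prodMkLeft Y κ)
    rw [lintegral_lintegral_swap h4.aemeasurable]
    exact lintegral_congr fun x' => lintegral_prod _ hH.aemeasurable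
  have hNN : (N : ℝ≥0∞)⁻¹ * N ≤ 1 := ENNReal.inv_mul_le_one _
  simp_rw [profileEnergy_kernelProfile]
  have m1 : ∀ i : Fin N, Measurable fun ω => ∫⁻ y, c (ξ i ω, y) ∂(κ (ξ i ω)) := fun i =>
    h1.comp (hξ_meas i)
  have m2 : ∀ i : Fin N, Measurable fun ω => ∫⁻ y, L y ∂(κ (ξ i ω)) := fun i =>
    h2.comp (hξ_meas i)
  have m3 : ∀ i j : Fin N, Measurable fun ω => ∫⁻ z, H z ∂((κ (ξ i ω)).prod (κ (ξ j ω))) :=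
    fun i j => h3.comp ((hξ_meas i).prodMk (hξ_meas j))
  have m1' := Finset.measurable_fun_sum Finset.univ fun i _ => m1 i
  have m2' := Finset.measurable_fun_sum Finset.univ fun i _ => m2 i
  have m3' : ∀ i : Fin N, Measurable fun ω =>
      ∑ j with j ≠ i, ∫⁻ z, H z ∂((κ (ξ i ω)).prod (κ (ξ j ω))) := fun i =>
    Finset.measurable_fun_sum _ fun j _ => m3 i j
  have m3'' := Finset.measurable_fun_sum Finset.univ fun i _ => m3' i
  rw [lintegral_add_right _ (m3''.const_mul _),
    lintegral_add_left (m1'.const_mul _), lintegral_const_mul _ m1', lintegral_const_mul _ m2',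
    lintegral_const_mul _ m3'', lintegral_finsetSum _ fun i _ => m1 i,
    lintegral_finsetSum _ fun i _ => m2 i, lintegral_finsetSum _ fun i _ => m3' i,
    limitPotential_of_mem hγ]
  simp_rw [e1, e2, Finset.sum_const, Finset.card_univ, Fintype.card_fin, nsmul_eq_mul]
  refine add_le_add (add_le_add ?_ ?_) ?_
  · rw [← mul_assoc]
    exact (mul_le_mul_left hNN _).trans (by rw [one_mul])
  · rw [← mul_assoc]
    exact (mul_le_mul_left hNN _).trans (by rw [one_mul])
  · set I := interaction H (sndMarginal γ) (sndMarginal γ) with hI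
    have h6 : ∀ i : Fin N,
        ∫⁻ ω, ∑ j with j ≠ i, ∫⁻ z, H z ∂((κ (ξ i ω)).prod (κ (ξ j ω))) ∂P ≤ N * I := by
      intro i
      rw [lintegral_finsetSum _ fun j _ => m3 i j]
      calc ∑ j with j ≠ i, ∫⁻ ω, ∫⁻ z, H z ∂((κ (ξ i ω)).prod (κ (ξ j ω))) ∂P
          = ∑ j with j ≠ i, I := Finset.sum_congr rfl fun j hj =>
            e3 i j fun h => (Finset.mem_filter.1 hj).2 (Fin.ext h.symm)
        _ ≤ ∑ _j : Fin N, I := Finset.sum_le_sum_of_subset (Finset.filter_subset _ _)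
        _ = N * I := by simp
    calc _ ≤ ((N : ℝ≥0∞) ^ 2)⁻¹ * ∑ _i : Fin N, N * I :=
          mul_le_mul_right (Finset.sum_le_sum fun i _ => h6 i) _
      _ = ((N : ℝ≥0∞)⁻¹ * N) * ((N : ℝ≥0∞)⁻¹ * N) * I := by
          rw [Finset.sum_const, Finset.card_univ, Fintype.card_fin, nsmul_eq_mul, sq,
            ENNReal.mul_inv (Or.inr (ENNReal.natCast_ne_top _))
              (Or.inl (ENNReal.natCast_ne_top _))]
          ring
      _ ≤ 1 * 1 * I := mul_le_mul_left (mul_le_mul' hNN hNN) _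
      _ = I := by ring

end Sampling

/-! ### Almost sure upper bound along a subsequence -/

section Convergence

theorem exists_markovKernel_of_mem_plansOver {X Y : Type*} [MeasurableSpace X]
    [TopologicalSpace Y] [PolishSpace Y] [MeasurableSpace Y] [BorelSpace Y]
    {μ : ProbabilityMeasure X} {γ : ProbabilityMeasure (X × Y)} (hγ : γ ∈ plansOver Y μ) :
    ∃ κ : Kernel X Y, IsMarkovKernel κ ∧ (μ : Measure X) ⊗ₘ κ = (γ : Measure (X × Y)) := by
  have : Nonempty Y := (nonempty_of_isProbabilityMeasure (γ : Measure (X × Y))).map Prod.snd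
  refine ⟨(γ : Measure (X × Y)).condKernel, inferInstance, ?_⟩
  have h := (γ : Measure (X × Y)).disintegrate (γ : Measure (X × Y)).condKernel
  rwa [show (γ : Measure (X × Y)).fst = (μ : Measure X) from hγ] at h

theorem ae_forall_exists_profileEnergy_lt_top {X Y Ω : Type*} [MeasurableSpace X]
    [TopologicalSpace Y] [PolishSpace Y] [MeasurableSpace Y] [BorelSpace Y] [MeasurableSpace Ω]
    {c : X × Y → ℝ≥0∞} {L : Y → ℝ≥0∞} {H : Y × Y → ℝ≥0∞} {μ : ProbabilityMeasure X}
    {P : Measure Ω} [IsProbabilityMeasure P] {ξ : ℕ → Ω → X}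
    (hξ_meas : ∀ i, Measurable (ξ i)) (hξ_indep : iIndepFun ξ P)
    (hξ_law : ∀ i, P.map (ξ i) = (μ : Measure X))
    (hc : Measurable c) (hL : Measurable L) (hH : Measurable H)
    {γ : ProbabilityMeasure (X × Y)} (hγ : γ ∈ plansOver Y μ)
    (hfin : limitPotential c L H μ γ < ⊤) :
    ∀ᵐ ω ∂P, ∀ N, ∃ ν, profileEnergy c L H (fun i : Fin N => ξ i ω) ν < ⊤ := by
  obtain ⟨κ, _, hκ⟩ := exists_markovKernel_of_mem_plansOver hγ
  refine ae_all_iff.2 fun N => ?_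
  have hm : Measurable fun ω => profileEnergy c L H (fun i : Fin N => ξ i ω)
      (kernelProfile κ fun i : Fin N => ξ i ω) :=
    (measurable_profileEnergy_kernelProfile κ hc hL hH).comp
      (measurable_pi_lambda _ fun i => hξ_meas i)
  filter_upwards [ae_lt_top hm (ne_top_of_le_ne_top hfin.ne
    (lintegral_profileEnergy_kernelProfile_le κ hξ_meas hξ_indep hξ_law hc hL hH hγ hκ N))]
    with ω hω
  exact ⟨_, hω⟩

variable {X Y Ω : Type*} [TopologicalSpace X] [PolishSpace X] [MeasurableSpace X] [BorelSpace X]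
  [TopologicalSpace Y] [PolishSpace Y] [MeasurableSpace Y] [BorelSpace Y]
  {c : X × Y → ℝ≥0∞} {L : Y → ℝ≥0∞} {H : Y × Y → ℝ≥0∞} {μ : ProbabilityMeasure X}

theorem iInf_limitPotential_le_liminf (hc : LowerSemicontinuous c) (hL : LowerSemicontinuous L)
    (hH : LowerSemicontinuous H)
    (hL_compact : ∀ r : ℝ≥0, 0 < r → IsCompact {y : Y | L y ≤ r}) {x : ℕ → X}
    (hx : Tendsto (empirical x) atTop (𝓝 μ)) (ν : ∀ n, Fin (n + 1) → ProbabilityMeasure Y) :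
    ⨅ γ ∈ plansOver Y μ, limitPotential c L H μ γ
      ≤ liminf (fun n => profileEnergy c L H (fun i : Fin (n + 1) => x i) (ν n)) atTop := by
  by_contra hlt
  obtain ⟨r, hr, hr'⟩ := exists_between (not_le.1 hlt)
  lift r to ℝ≥0 using (hr'.trans_le le_top).ne
  obtain ⟨φ, hφ, hE⟩ := extraction_of_frequently_atTop (frequently_lt_of_liminf_lt (h := hr))
  have hγ : ∀ n, ∃ γ : ProbabilityMeasure (X × Y), (γ : Measure (X × Y))
      = profilePlan (fun i : Fin (φ n + 1) => x i) (ν (φ n)) := fun n =>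
    ⟨⟨_, isProbabilityMeasure_profilePlan (by omega) _ _⟩, rfl⟩
  choose γ hγ using hγ
  obtain ⟨-, γ', -, -, hγ', hle⟩ := exists_subseq_tendsto_of_profileEnergy_le hc hL hH hL_compact hx
    hφ hγ (ℓ := r) (ε := fun _ => 0) tendsto_const_nhds fun n => by simpa using (hE n).le
  exact absurd ((iInf₂_le γ' hγ').trans hle) (not_le.2 hr')

variable [MeasurableSpace Ω] {P : Measure Ω} [IsProbabilityMeasure P] {ξ : ℕ → Ω → X}

/-- A nonnegative excess with zero mean vanishes: the liminf energies `u k` are at least `m` by the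
lower bound, and by Fatou their means are at most `m + 1/(k+1)`, so `⨅ k, u k = m` almost surely. -/
theorem ae_frequently_exists_profileEnergy_lt
    (hξ_meas : ∀ i, Measurable (ξ i)) (hξ_indep : iIndepFun ξ P)
    (hξ_law : ∀ i, P.map (ξ i) = (μ : Measure X))
    (hc : LowerSemicontinuous c) (hL : LowerSemicontinuous L) (hH : LowerSemicontinuous H)
    (hL_compact : ∀ r : ℝ≥0, 0 < r → IsCompact {y : Y | L y ≤ r})
    (h_inf : (⨅ γ ∈ plansOver Y μ, limitPotential c L H μ γ) < ⊤) :
    ∀ᵐ ω ∂P, ∀ b, (⨅ γ ∈ plansOver Y μ, limitPotential c L H μ γ) < b →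
      ∃ᶠ N : ℕ in atTop, ∃ ν, profileEnergy c L H (fun i : Fin (N + 1) => ξ i ω) ν < b := by
  set m := ⨅ γ ∈ plansOver Y μ, limitPotential c L H μ γ with hm_def
  have hcm := hc.measurable
  have hLm := hL.measurable
  have hHm := hH.measurable
  have hex : ∀ k : ℕ, ∃ γ ∈ plansOver Y μ,
      limitPotential c L H μ γ < m + ((1 / ((k : ℝ≥0) + 1) : ℝ≥0) : ℝ≥0∞) := fun k => by
    have h1 : m < m + ((1 / ((k : ℝ≥0) + 1) : ℝ≥0) : ℝ≥0∞) :=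
      ENNReal.lt_add_right h_inf.ne (by
        rw [Ne, ENNReal.coe_eq_zero]
        positivity)
    obtain ⟨γ, hγ⟩ := iInf_lt_iff.1 (hm_def ▸ h1)
    obtain ⟨h2, h3⟩ := iInf_lt_iff.1 hγ
    exact ⟨γ, h2, h3⟩
  choose γ hγ hγ_lt using hex
  choose κ hκ_markov hκ using fun k => exists_markovKernel_of_mem_plansOver (hγ k)
  let U : ℕ → ℕ → Ω → ℝ≥0∞ := fun k n ω => profileEnergy c L H (fun i : Fin (n + 1) => ξ i ω)
    (kernelProfile (κ k) fun i : Fin (n + 1) => ξ i ω)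
  have hU : ∀ k n, Measurable (U k n) := fun k n =>
    (measurable_profileEnergy_kernelProfile (κ k) hcm hLm hHm).comp
      (measurable_pi_lambda _ fun i => hξ_meas i)
  let u : ℕ → Ω → ℝ≥0∞ := fun k ω => liminf (fun n => U k n ω) atTop
  have hu : ∀ k, Measurable (u k) := fun k => Measurable.liminf (hU k)
  have hu_int : ∀ k, ∫⁻ ω, u k ω ∂P ≤ m + ((1 / ((k : ℝ≥0) + 1) : ℝ≥0) : ℝ≥0∞) := fun k => by
    refine (lintegral_liminf_le (hU k)).trans (le_trans ?_ (hγ_lt k).le)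
    refine liminf_le_of_frequently_le' (Frequently.of_forall fun n => ?_)
    exact lintegral_profileEnergy_kernelProfile_le (κ k) hξ_meas hξ_indep hξ_law hcm hLm hHm (hγ k)
      (hκ k) (n + 1)
  have hge : ∀ᵐ ω ∂P, m ≤ ⨅ k, u k ω := by
    filter_upwards [ae_tendsto_empirical hξ_meas hξ_indep hξ_law] with ω hω
    exact le_iInf fun k => iInf_limitPotential_le_liminf hc hL hH hL_compact hω _
  have hle : ∫⁻ ω, ⨅ k, u k ω ∂P ≤ ∫⁻ _, m ∂P := by
    rw [lintegral_const, measure_univ, mul_one]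
    have hlim : Tendsto (fun k : ℕ => m + ((1 / ((k : ℝ≥0) + 1) : ℝ≥0) : ℝ≥0∞)) atTop
        (𝓝 (m + ((0 : ℝ≥0) : ℝ≥0∞))) :=
      tendsto_const_nhds.add (ENNReal.tendsto_coe.2 tendsto_one_div_add_atTop_nhds_zero_nat)
    rw [ENNReal.coe_zero, add_zero] at hlim
    exact ge_of_tendsto' hlim fun k => (lintegral_mono fun ω => iInf_le _ k).trans (hu_int k)
  filter_upwards [ae_eq_of_ae_le_of_lintegral_le hge (by simpa using h_inf.ne)
    (Measurable.iInf hu).aemeasurable hle] with ω hω b hb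
  rw [hω] at hb
  obtain ⟨k, hk⟩ := iInf_lt_iff.1 hb
  exact (frequently_lt_of_liminf_lt (h := hk)).mono fun n hn => ⟨_, hn⟩

end Convergence

end CournotNash

/-! ### Minimizers, equilibria and their limits for almost every sample -/

theorem theorem4p10
    {X Y Ω : Type*}
    [TopologicalSpace X] [PolishSpace X] [MeasurableSpace X] [BorelSpace X]
    [TopologicalSpace Y] [PolishSpace Y] [MeasurableSpace Y] [BorelSpace Y]
    [MeasurableSpace Ω] (P : Measure Ω) [IsProbabilityMeasure P]
    (μ : ProbabilityMeasure X) (hμ : ∀ x : X, (μ : Measure X) {x} = 0)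
    (ξ : ℕ → Ω → X) (hξ_meas : ∀ i, Measurable (ξ i)) (hξ_indep : iIndepFun ξ P)
    (hξ_law : ∀ i, P.map (ξ i) = (μ : Measure X))
    (c : X × Y → ℝ≥0∞) (L : Y → ℝ≥0∞) (H : Y × Y → ℝ≥0∞)
    (hc : LowerSemicontinuous c) (hL : LowerSemicontinuous L) (hH : LowerSemicontinuous H)
    (hH_symm : ∀ y y' : Y, H (y, y') = H (y', y))
    (hL_compact : ∀ r : ℝ≥0, 0 < r → IsCompact {y : Y | L y ≤ r})
    (h_inf : (⨅ γ ∈ CournotNash.plansOver Y μ, CournotNash.limitPotential c L H μ γ) < ⊤) :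
    (∀ᵐ ω ∂P,
      (∃ γ : ℕ → ProbabilityMeasure (X × Y), ∀ N : ℕ, 1 ≤ N →
        CournotNash.IsClosedLoopMinimizer c L H (fun i : Fin N => ξ i ω) (γ N)) ∧
      (∀ γ : ℕ → ProbabilityMeasure (X × Y),
        (∀ N : ℕ, 1 ≤ N →
          CournotNash.IsClosedLoopMinimizer c L H (fun i : Fin N => ξ i ω) (γ N)) →
        (∀ N : ℕ, 1 ≤ N →
          CournotNash.IsClosedLoopNash c L H (fun i : Fin N => ξ i ω) (γ N)) ∧
        ∃ (φ : ℕ → ℕ) (γ' : ProbabilityMeasure (X × Y)), StrictMono φ ∧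
          Tendsto (γ ∘ φ) atTop (𝓝 γ') ∧
          γ' ∈ CournotNash.plansOver Y μ ∧
          (CournotNash.RegularizationCondition c L H →
            CournotNash.IsCournotNash (CournotNash.meanFieldCost c L H) μ γ'))) ∧
    (Continuous H → (∃ M : ℝ≥0, ∀ z : Y × Y, H z ≤ M) →
      ∀ᵐ ω ∂P, ∀ (γ : ℕ → ProbabilityMeasure (X × Y)) (γ' : ProbabilityMeasure (X × Y)),
        (∀ N : ℕ, 1 ≤ N →
          CournotNash.IsClosedLoopNash c L H (fun i : Fin N => ξ i ω) (γ N)) →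
        Tendsto γ atTop (𝓝 γ') →
        γ' ∈ CournotNash.plansOver Y μ ∧
        CournotNash.IsCournotNash (CournotNash.meanFieldCost c L H) μ γ') := by
  obtain ⟨γ₀, hγ₀, hfin₀⟩ : ∃ γ ∈ CournotNash.plansOver Y μ,
      CournotNash.limitPotential c L H μ γ < ⊤ := by
    obtain ⟨γ, hγ⟩ := iInf_lt_iff.1 h_inf
    obtain ⟨h1, h2⟩ := iInf_lt_iff.1 hγ
    exact ⟨γ, h1, h2⟩
  have : Nonempty Y := (nonempty_of_isProbabilityMeasure (γ₀ : Measure (X × Y))).map Prod.snd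
  refine ⟨?_, fun hHc ⟨M, hM⟩ => CournotNash.ae_isCournotNash_of_tendsto_isClosedLoopNash hξ_meas
    hξ_indep hξ_law hc hL hHc hM hL_compact hγ₀ hfin₀⟩
  filter_upwards [CournotNash.ae_tendsto_empirical hξ_meas hξ_indep hξ_law,
    CournotNash.ae_injective_of_noAtoms hμ hξ_meas hξ_indep hξ_law,
    CournotNash.ae_forall_exists_profileEnergy_lt_top hξ_meas hξ_indep hξ_law hc.measurable
      hL.measurable hH.measurable hγ₀ hfin₀,
    CournotNash.ae_frequently_exists_profileEnergy_lt hξ_meas hξ_indep hξ_law hc hL hH hL_compact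
      h_inf] with ω hω_emp hω_inj hω_fin hω_freq
  constructor
  · have h : ∀ N : ℕ, ∃ γ : ProbabilityMeasure (X × Y), 1 ≤ N →
        CournotNash.IsClosedLoopMinimizer c L H (fun i : Fin N => ξ i ω) γ := fun N => by
      by_cases hN : 1 ≤ N
      · obtain ⟨γ, hγ⟩ := CournotNash.exists_isClosedLoopMinimizer hN hc hL hH hL_compact
          fun i : Fin N => ξ i ω
        exact ⟨γ, fun _ => hγ⟩
      -- A default plan for `N = 0`, about which nothing is claimed.
      · exact ⟨γ₀, fun h => absurd h hN⟩
    choose γ hγ using h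
    exact ⟨γ, hγ⟩
  intro γ hγ
  have hprofile : ∀ N : ℕ, 1 ≤ N → ∃ ν : Fin N → ProbabilityMeasure Y,
      (γ N : Measure (X × Y)) = CournotNash.profilePlan (fun i : Fin N => ξ i ω) ν ∧
      ∀ ν', CournotNash.profileEnergy c L H (fun i : Fin N => ξ i ω) ν
        ≤ CournotNash.profileEnergy c L H (fun i : Fin N => ξ i ω) ν' := fun N hN => by
    obtain ⟨ν₀, hν₀⟩ := hω_fin N
    exact (hγ N hN).exists_profile hc.measurable hN (hω_inj.comp Fin.val_injective) hν₀
  refine ⟨fun N hN => ?_, ?_⟩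
  · obtain ⟨ν, hν, hmin⟩ := hprofile N hN
    obtain ⟨ν₀, hν₀⟩ := hω_fin N
    exact ⟨ν, hν, CournotNash.isNashEquilibrium_of_forall_le hH.measurable hH_symm
      ((hmin ν₀).trans_lt hν₀) hmin⟩
  set m := ⨅ γ ∈ CournotNash.plansOver Y μ, CournotNash.limitPotential c L H μ γ with hm
  have hlt : ∀ n : ℕ, m < m + ((1 / ((n : ℝ≥0) + 1) : ℝ≥0) : ℝ≥0∞) := fun n =>
    ENNReal.lt_add_right h_inf.ne (by
      rw [Ne, ENNReal.coe_eq_zero]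
      positivity)
  -- The subsequence depends on `ω`, and its `n`-th game has `φ n + 1` players; some profile there
  -- has energy below `m + 1/(n+1)`, hence so does the minimizer.
  obtain ⟨φ, hφ, hφ_lt⟩ := extraction_forall_of_frequently fun n => hω_freq _ (hlt n)
  choose ν hν hν_min using fun n => hprofile (φ n + 1) (Nat.le_add_left 1 _)
  obtain ⟨ψ, γ', hψ, hγ', hγ'_mem, hγ'_le⟩ :=
    CournotNash.exists_subseq_tendsto_of_profileEnergy_le hc hL hH hL_compact hω_emp hφ
      (γ := fun n => γ (φ n + 1)) hν (ℓ := m.toNNReal) (ε := fun n : ℕ => 1 / ((n : ℝ≥0) + 1))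
      tendsto_one_div_add_atTop_nhds_zero_nat fun n => by
        rw [ENNReal.coe_toNNReal h_inf.ne]
        obtain ⟨ν₀, hν₀⟩ := hφ_lt n
        exact (hν_min n ν₀).trans hν₀.le
  rw [ENNReal.coe_toNNReal h_inf.ne] at hγ'_le
  refine ⟨fun n => φ (ψ n) + 1, γ', fun a b hab => Nat.succ_lt_succ (hφ (hψ hab)), hγ', hγ'_mem,
    CournotNash.isCournotNash_of_minimizer hc hL hH hH_symm hL_compact hγ'_mem
      (hγ'_le.trans_lt h_inf) fun ρ hρ => hγ'_le.trans (iInf₂_le ρ hρ)⟩
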